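/- Consider the class of equations \[ u_t+f(t)u_x+g(t)uu_x+h(t)u_{xxt}=0, \tag{1} \] where the arbitrary elements $f,g,h$ are smooth real functions on an open interval and $gh\neq0$ there. A point transformation is a smooth map $\tilde t=T(t,x,u)$, $\tilde x=X(t,x,u)$, $\tilde u=U(t,x,u)$ with nonvanishing Jacobian on a connected open set $\Omega\subset\mathbb R^3$. It maps one equation of the class to another if its prolongation, wherever defined over $\Omega$, takes third-order jets of functions $u(t,x)$ that satisfy the first equation, and only those, to jets satisfying the second. A usual equivalence transformation of class (1) over $\Omega$ consists of such a point transformation together with components $\tilde f,\tilde g,\tilde h$, functions of $(t,x,u,f,g,h)$ with $gh\ne0$, such that the joint map is smooth with nonvanishing Jacobian and maps every equation of the class (over the part of $\Omega$ where its coefficients are defined) to an equation of the class whose coefficients are given by these components. These transformations form the usual equivalence group $G^\sim_1$, understood locally. Theorem. The usual equivalence group $G^\sim_1$ of class (1) is comprised of the transformations \[ \tilde t=T(t),\quad \tilde x=\delta_1x+\delta_2,\quad \tilde u=\delta_3u+\delta_4,\quad \tilde f=\frac{\delta_1}{T_t\delta_3}(\delta_3f-\delta_4g),\quad \tilde g=\frac{\delta_1}{T_t\delta_3}\,g,\quad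 \tilde h=\delta_1^2h, \] where $\delta_1,\dots,\delta_4$ are arbitrary constants with $\delta_1\delta_3\neq0$ and $T=T(t)$ is an arbitrary smooth function (on the projection of $\Omega$ to the $t$-axis) with $T_t\neq0$. Class (1) is normalized in the usual sense: whenever a point transformation on a connected open set $\Omega$ maps an equation of class (1) with coefficients $f,g,h$ to an equation of class (1) with coefficients $\tilde f,\tilde g,\tilde h$ (all coefficients being defined at the relevant values of $t$ and $\tilde t$), it is the $(t,x,u)$-part of an element of $G^\sim_1$ over $\Omega$ that transforms $f,g,h$ to $\tilde f,\tilde g,\tilde h$. -/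

import Mathlib

open Set Filter Topology
open scoped ContDiff

namespace BBM

/-- The space of `(t, x, u)`: independent variables `t`, `x` and dependent variable `u`. -/
abbrev TXU : Type := ℝ × ℝ × ℝ

/-- The space of values `(f, g, h)` of the arbitrary elements. -/
abbrev FGH : Type := ℝ × ℝ × ℝ

/-- An equation `u_t + f(t) u_x + g(t) u u_x + h(t) u_{xxt} = 0` of the class: the coefficients are
smooth functions on an open interval `I` (bounded or not), and `g h ≠ 0` on `I`. The values of the
coefficients outside `I` play no role. -/
structure Equation where
  I : Set ℝ
  f : ℝ → ℝ
  g : ℝ → ℝ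
  h : ℝ → ℝ
  isOpen_I : IsOpen I
  isConnected_I : IsConnected I
  smooth_f : ContDiffOn ℝ ∞ f I
  smooth_g : ContDiffOn ℝ ∞ g I
  smooth_h : ContDiffOn ℝ ∞ h I
  gh_ne_zero : ∀ t ∈ I, g t * h t ≠ 0

/-- The values of the arbitrary elements of an equation at `t`. -/
def Equation.coeff (θ : Equation) (t : ℝ) : FGH := (θ.f t, θ.g t, θ.h t)

/-- The partial derivative `∂u/∂t` of a function `u` of `(t, x)`. -/
noncomputable def dt (u : ℝ × ℝ → ℝ) (p : ℝ × ℝ) : ℝ := fderiv ℝ u p (1, 0)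

/-- The partial derivative `∂u/∂x` of a function `u` of `(t, x)`. -/
noncomputable def dx (u : ℝ × ℝ → ℝ) (p : ℝ × ℝ) : ℝ := fderiv ℝ u p (0, 1)

/-- The function `u` satisfies the equation `θ` at the single point `p = (t, x)`, that is, the third
order jet of `u` at `p` lies on the manifold defined by `θ` in the third order jet space. -/
def Equation.HoldsAt (θ : Equation) (u : ℝ × ℝ → ℝ) (p : ℝ × ℝ) : Prop :=
  dt u p + θ.f p.1 * dx u p + θ.g p.1 * u p * dx u p + θ.h p.1 * dt (dx (dx u)) p = 0

/-- `Φ` is smooth with nonvanishing Jacobian on `Ω`. -/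
def IsPointTransformation {E : Type*} [NormedAddCommGroup E] [NormedSpace ℝ E]
    (Ω : Set E) (Φ : E → E) : Prop :=
  ContDiffOn ℝ ∞ Φ Ω ∧ ∀ z ∈ Ω, (fderiv ℝ Φ z).det ≠ 0

/-- The lift of `(t, x)` to the graph of `u`. -/
def graphPoint (u : ℝ × ℝ → ℝ) (p : ℝ × ℝ) : TXU := (p.1, p.2, u p)

/-- The new independent variables `(t', x') = (T, X)`, evaluated along the graph of `u`. -/
def newBase (Φ : TXU → TXU) (u : ℝ × ℝ → ℝ) (p : ℝ × ℝ) : ℝ × ℝ :=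
  ((Φ (graphPoint u p)).1, (Φ (graphPoint u p)).2.1)

/-- `v` is, near the image of `p`, the function into which `Φ` transforms `u` near `p`:
`v(T(t,x,u(t,x)), X(t,x,u(t,x))) = U(t,x,u(t,x))` for `(t, x)` near `p`, where `(T, X)` restricted
to the graph of `u` is nondegenerate at `p`. Then the jet of `v` at the image of `p` is the image of
the jet of `u` at `p` under the prolongation of `Φ`, and every jet at which this prolongation is
defined arises in this way. -/
def TransformsAt (Φ : TXU → TXU) (u v : ℝ × ℝ → ℝ) (p : ℝ × ℝ) : Prop :=
  ContDiffAt ℝ ∞ u p ∧ ContDiffAt ℝ ∞ v (newBase Φ u p) ∧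
    (fderiv ℝ (newBase Φ u) p).det ≠ 0 ∧
    ∀ᶠ q in 𝓝 p, v (newBase Φ u q) = (Φ (graphPoint u q)).2.2

/-- On `Ω` the transformation `Φ` maps the equation `θ` to the equation `θ'`: a third order jet over
`Ω` at which the prolongation of `Φ` is defined lies on the manifold of `θ` if and only if its image
lies on the manifold of `θ'`. -/
def MapsEquation (Ω : Set TXU) (Φ : TXU → TXU) (θ θ' : Equation) : Prop :=
  (∀ z ∈ Ω, z.1 ∈ θ.I ∧ (Φ z).1 ∈ θ'.I) ∧
    ∀ (u v : ℝ × ℝ → ℝ) (p : ℝ × ℝ), graphPoint u p ∈ Ω → TransformsAt Φ u v p →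
      (θ.HoldsAt u p ↔ θ'.HoldsAt v (newBase Φ u p))

/-- An admissible transformation of the class: two equations and a point transformation, on a
connected open domain, of the first equation to the second. -/
def IsAdmissible (Ω : Set TXU) (Φ : TXU → TXU) (θ θ' : Equation) : Prop :=
  IsOpen Ω ∧ IsConnected Ω ∧ IsPointTransformation Ω Φ ∧ MapsEquation Ω Φ θ θ'

/-- On `Ω`, the transformation `(Φ, Θ)` of variables and arbitrary elements sends the coefficients of
`θ` to those of `θ'`. -/
def Induces (Ω : Set TXU) (Φ : TXU → TXU) (Θ : TXU × FGH → FGH) (θ θ' : Equation) : Prop :=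
  ∀ z ∈ Ω, θ'.coeff (Φ z).1 = Θ (z, θ.coeff z.1)

/-- `(t, x, u, f, g, h) ↦ (Φ (t, x, u), Θ (t, x, u, f, g, h))` is a usual equivalence transformation
of the class over the connected open domain `Ω` of the space of `(t, x, u)`: it is a nondegenerate
smooth transformation, defined for all values `(f, g, h)` with `g h ≠ 0`, whose `(t, x, u)`-part does
not depend on the arbitrary elements, and it maps every equation `θ` of the class (over the part of
`Ω` where the coefficients of `θ` are defined) to an equation of the class. -/
def IsUsualEquivalence (Ω : Set TXU) (Φ : TXU → TXU) (Θ : TXU × FGH → FGH) : Prop :=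
  IsOpen Ω ∧ IsConnected Ω ∧ IsPointTransformation Ω Φ ∧
    IsPointTransformation {w : TXU × FGH | w.1 ∈ Ω ∧ w.2.2.1 * w.2.2.2 ≠ 0}
      (fun w => (Φ w.1, Θ w)) ∧
    ∀ θ : Equation, ∃ θ' : Equation,
      MapsEquation {z ∈ Ω | z.1 ∈ θ.I} Φ θ θ' ∧ Induces {z ∈ Ω | z.1 ∈ θ.I} Φ Θ θ θ'

/-- The class is normalized in the usual sense: every admissible transformation is induced by a
usual equivalence transformation. -/
def IsNormalized : Prop :=
  ∀ (Ω : Set TXU) (Φ : TXU → TXU) (θ θ' : Equation), IsAdmissible Ω Φ θ θ' →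
    ∃ Θ : TXU × FGH → FGH, IsUsualEquivalence Ω Φ Θ ∧ Induces Ω Φ Θ θ θ'

end BBM

/-! The only third-order term of an equation of the class is `h u_txx`, whose symbol is the binary
cubic τξ², and a point transformation has to respect it. Perturb `u` near a point by a cubic form
`K`. The transform `v` of `u` then changes, to leading order, by a nonzero multiple of `K ∘ L⁻¹`,
where `L` is the derivative of (T, X) along the graph of `u` (`exists_cubic_asymptotics`). If `K`
has no tx² term, the perturbed function still satisfies the equation at the point, so `K ∘ L⁻¹` has
no tx² term either (`MapsEquation.cubic_condition`). Testing t³, x³ and t²x forces `L` to be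
diagonal (`MapsEquation.diagonal`). Since the slopes of `u` at a point are free, T_x = T_u = X_t =
X_u = 0 (`MapsEquation.base_partials`).

The transformed equation can now be written out as a polynomial identity in the free jets u_t, u_x,
u_xx, u_tx (`MapsEquation.determining`). Its coefficients give U_uu = U_tu = 0, 2X_x U_xu = X_xx U_u
and a relation T_t X_x (f̃ + g̃U) h = h̃ (f + gu). Differentiating this relation in u and then in x
gives X_xx U_u + X_x U_xu = 0. Hence X_xx = U_xu = 0, then U_x = U_t = 0, and the formulas for the
new coefficients follow (`MapsEquation.determinedAt`).

Connectedness of Ω turns the vanishing derivatives into constants δ₁, …, δ₄. That T is a single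
function of t is subtler, because the slices t = const of Ω may be disconnected; it follows from the
relation between g and g̃ (`MapsEquation.exists_normalForm`).

Conversely, a transformation in normal form multiplies the left-hand side of the equation by δ₃/T_t
(`HasNormalForm.mapsEquation`). The whole derivation of the normal form uses a single pair of
equations, so it yields normalization directly, while constant-coefficient equations pin down the
coefficient components of an equivalence transformation. -/

namespace BBM

/-! ### Directional derivatives, and jets read off from asymptotics along lines. -/

section Calculus

variable {E : Type*} [NormedAddCommGroup E] [NormedSpace ℝ E]

/-- The derivative of a real function in the direction of a fixed vector. -/
noncomputable def dirDeriv (e : E) (A : E → ℝ) (z : E) : ℝ := fderiv ℝ A z e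

theorem dt_eq_dirDeriv (u : ℝ × ℝ → ℝ) : dt u = dirDeriv (1, 0) u := rfl

theorem dx_eq_dirDeriv (u : ℝ × ℝ → ℝ) : dx u = dirDeriv (0, 1) u := rfl

theorem contDiffAt_dirDeriv {A : E → ℝ} {z : E} (e : E) (hA : ContDiffAt ℝ ∞ A z) :
    ContDiffAt ℝ ∞ (dirDeriv e A) z := by
  have h : ContDiffAt ℝ ∞ (fderiv ℝ A) z := hA.fderiv_right (by simp)
  exact h.clm_apply contDiffAt_const

theorem differentiableAt_of_smooth {F : Type*} [NormedAddCommGroup F] [NormedSpace ℝ F]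
    {A : E → F} {z : E} (hA : ContDiffAt ℝ ∞ A z) : DifferentiableAt ℝ A z :=
  hA.differentiableAt (by simp)

theorem eventually_differentiableAt {F : Type*} [NormedAddCommGroup F] [NormedSpace ℝ F]
    {A : E → F} {z : E} (hA : ContDiffAt ℝ ∞ A z) : ∀ᶠ y in 𝓝 z, DifferentiableAt ℝ A y := by
  have h : ContDiffAt ℝ 1 A z := hA.of_le (by exact_mod_cast le_top)
  filter_upwards [h.eventually (by decide)] with y hy
  exact hy.differentiableAt (by simp)

theorem dirDeriv_congr {A B : E → ℝ} {z : E} (e : E) (h : A =ᶠ[𝓝 z] B) :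
    dirDeriv e A =ᶠ[𝓝 z] dirDeriv e B := by
  filter_upwards [h.fderiv (𝕜 := ℝ)] with y hy
  simp [dirDeriv, hy]

theorem dirDeriv_add {A B : E → ℝ} {z : E} (e : E) (hA : ContDiffAt ℝ ∞ A z)
    (hB : ContDiffAt ℝ ∞ B z) :
    dirDeriv e (fun y => A y + B y) =ᶠ[𝓝 z] fun y => dirDeriv e A y + dirDeriv e B y := by
  filter_upwards [eventually_differentiableAt hA, eventually_differentiableAt hB] with y ha hb
  simp [dirDeriv, fderiv_fun_add ha hb]

theorem dirDeriv_mul {A B : E → ℝ} {z : E} (e : E) (hA : ContDiffAt ℝ ∞ A z)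
    (hB : ContDiffAt ℝ ∞ B z) :
    dirDeriv e (fun y => A y * B y) =ᶠ[𝓝 z]
      fun y => dirDeriv e A y * B y + A y * dirDeriv e B y := by
  filter_upwards [eventually_differentiableAt hA, eventually_differentiableAt hB] with y ha hb
  simp [dirDeriv, fderiv_fun_mul ha hb]
  ring

theorem hasDerivAt_line {A : E → ℝ} {z : E} (e : E) (s : ℝ)
    (hA : DifferentiableAt ℝ A (z + s • e)) :
    HasDerivAt (fun r : ℝ => A (z + r • e)) (dirDeriv e A (z + s • e)) s := by
  have h1 : HasDerivAt (fun r : ℝ => z + r • e) e s := by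
    simpa using ((hasDerivAt_id s).smul_const e).const_add z
  exact hA.hasFDerivAt.comp_hasDerivAt s h1

/-- The equality is needed between germs, and not only at `z`, so that it can be differentiated
again. -/
theorem dirDeriv_comm_eventually {A : E → ℝ} {z : E} (e e' : E)
    (hA : ContDiffAt ℝ ∞ A z) :
    dirDeriv e (dirDeriv e' A) =ᶠ[𝓝 z] dirDeriv e' (dirDeriv e A) := by
  have h2 : ContDiffAt ℝ 2 A z := contDiffAt_infty.1 hA 2
  filter_upwards [h2.eventually (by decide)] with y hy
  have h : DifferentiableAt ℝ (fderiv ℝ A) y :=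
    (hy.fderiv_right (m := 1) (by norm_num)).differentiableAt (by simp)
  have hs := hy.isSymmSndFDerivAt (by simp)
  have key : ∀ a b : E, dirDeriv a (dirDeriv b A) y = fderiv ℝ (fderiv ℝ A) y a b := by
    intro a b
    change fderiv ℝ (fun q => fderiv ℝ A q b) y a = _
    rw [fderiv_clm_apply h (differentiableAt_const b)]
    simp
  rw [key, key]
  exact hs e e'

theorem dirDeriv_comm {A : E → ℝ} {z : E} (e e' : E) (hA : ContDiffAt ℝ ∞ A z) :
    dirDeriv e (dirDeriv e' A) z = dirDeriv e' (dirDeriv e A) z :=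
  (dirDeriv_comm_eventually e e' hA).self_of_nhds

theorem dirDeriv_add_smul {A : E → ℝ} (a b : E) (k : ℝ) (z : E) :
    dirDeriv (a + k • b) A z = dirDeriv a A z + k * dirDeriv b A z := by
  simp [dirDeriv]

/-- The first and third derivatives of a function of one variable which is asymptotic to a
multiple of the cube. -/
theorem derivs_of_tendsto_div_cube {φ φ₁ φ₂ : ℝ → ℝ} {k l : ℝ}
    (h0 : ∀ᶠ s in 𝓝 (0 : ℝ), HasDerivAt φ (φ₁ s) s)
    (h1 : ∀ᶠ s in 𝓝 (0 : ℝ), HasDerivAt φ₁ (φ₂ s) s)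
    (h2 : HasDerivAt φ₂ k 0)
    (hl : Tendsto (fun s => φ s / s ^ 3) (𝓝[≠] 0) (𝓝 l)) :
    φ 0 = 0 ∧ φ₁ 0 = 0 ∧ k = 6 * l := by
  have hid : Tendsto (fun s : ℝ => s) (𝓝[≠] 0) (𝓝 0) := tendsto_id.mono_left nhdsWithin_le_nhds
  have hne : ∀ᶠ s : ℝ in 𝓝[≠] 0, s ≠ 0 := eventually_mem_nhdsWithin
  have e0 : ∀ᶠ s in 𝓝[≠] (0 : ℝ), HasDerivAt φ (φ₁ s) s := h0.filter_mono nhdsWithin_le_nhds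
  have e1 : ∀ᶠ s in 𝓝[≠] (0 : ℝ), HasDerivAt φ₁ (φ₂ s) s := h1.filter_mono nhdsWithin_le_nhds
  have c0 : Tendsto φ (𝓝[≠] 0) (𝓝 (φ 0)) :=
    h0.self_of_nhds.continuousAt.tendsto.mono_left nhdsWithin_le_nhds
  have c1 : Tendsto φ₁ (𝓝[≠] 0) (𝓝 (φ₁ 0)) :=
    h1.self_of_nhds.continuousAt.tendsto.mono_left nhdsWithin_le_nhds
  have c2 : Tendsto φ₂ (𝓝[≠] 0) (𝓝 (φ₂ 0)) :=
    h2.continuousAt.tendsto.mono_left nhdsWithin_le_nhds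
  have z0 : φ 0 = 0 := by
    refine tendsto_nhds_unique c0 (Tendsto.congr' ?_ (by simpa using hl.mul (hid.pow 3)))
    filter_upwards [hne] with s hs
    field_simp
  have z0' : Tendsto φ (𝓝[≠] 0) (𝓝 0) := by rwa [z0] at c0
  -- For j = 1, 2 the quotient φ/s^j has two descriptions: L'Hôpital gives the j-th derivative over
  -- j!, while φ/s^j = (φ/s³)·s^(3-j) tends to 0. Each vanishing derivative licenses the next use of
  -- L'Hôpital.
  have q1 : Tendsto (fun s => φ s / s) (𝓝[≠] 0) (𝓝 (φ₁ 0)) := by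
    refine HasDerivAt.lhopital_zero_nhdsNE (f' := φ₁) (g' := fun _ => 1) e0
      (Eventually.of_forall fun s => hasDerivAt_id s) (by simp) z0' hid (by simpa using c1)
  have z1 : φ₁ 0 = 0 := by
    refine tendsto_nhds_unique q1 (Tendsto.congr' ?_ (by simpa using hl.mul (hid.pow 2)))
    filter_upwards [hne] with s hs
    field_simp
  have z1' : Tendsto φ₁ (𝓝[≠] 0) (𝓝 0) := by rwa [z1] at c1
  have q2 : Tendsto (fun s => φ s / s ^ 2) (𝓝[≠] 0) (𝓝 (φ₂ 0 / 2)) := by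
    refine HasDerivAt.lhopital_zero_nhdsNE (f' := φ₁) (g' := fun s => 2 * s) e0
      (Eventually.of_forall fun s => by simpa using hasDerivAt_pow 2 s)
      (by filter_upwards [hne] with s hs; simpa using hs) z0' (by simpa using hid.pow 2) ?_
    refine HasDerivAt.lhopital_zero_nhdsNE (f' := φ₂) (g' := fun s => 2) e1
      (Eventually.of_forall fun s => by simpa using (hasDerivAt_id s).const_mul 2)
      (by simp) z1' (by simpa using hid.const_mul 2) (c2.div_const 2)
  have z2 : φ₂ 0 = 0 := by
    have : φ₂ 0 / 2 = 0 := by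
      refine tendsto_nhds_unique q2 (Tendsto.congr' ?_ (by simpa using hl.mul hid))
      filter_upwards [hne] with s hs
      field_simp
    linarith
  have z2' : Tendsto φ₂ (𝓝[≠] 0) (𝓝 0) := by rwa [z2] at c2
  have q3 : Tendsto (fun s => φ s / s ^ 3) (𝓝[≠] 0) (𝓝 (k / 6)) := by
    refine HasDerivAt.lhopital_zero_nhdsNE (f' := φ₁) (g' := fun s => 3 * s ^ 2) e0
      (Eventually.of_forall fun s => by simpa using hasDerivAt_pow 3 s)
      (by filter_upwards [hne] with s hs; simpa using hs) z0' (by simpa using hid.pow 3) ?_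
    refine HasDerivAt.lhopital_zero_nhdsNE (f' := φ₂) (g' := fun s => 6 * s) e1
      (Eventually.of_forall fun s => by
        refine ((hasDerivAt_pow 2 s).const_mul 3).congr_deriv ?_
        norm_num
        ring)
      (by filter_upwards [hne] with s hs; simpa using hs) z1'
      (by simpa using (hid.pow 2).const_mul 3) ?_
    -- `φ₂` is differentiable only at 0, so the last step is the definition of the derivative there.
    have := h2.tendsto_slope
    refine Tendsto.congr' ?_ (this.div_const 6)
    filter_upwards [hne] with s hs
    simp [slope_def_field, z2]
    field_simp
  have := tendsto_nhds_unique hl q3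
  exact ⟨z0, z1, by linarith⟩

theorem derivs_of_tendsto_div_cube_line {w : E → ℝ} {y : E} (hw : ContDiffAt ℝ ∞ w y) (ζ : E)
    {l : ℝ} (hl : Tendsto (fun s : ℝ => w (y + s • ζ) / s ^ 3) (𝓝[≠] 0) (𝓝 l)) :
    w y = 0 ∧ dirDeriv ζ w y = 0 ∧ dirDeriv ζ (dirDeriv ζ (dirDeriv ζ w)) y = 6 * l := by
  have hc : Tendsto (fun s : ℝ => y + s • ζ) (𝓝 0) (𝓝 y) := by
    have : Continuous fun s : ℝ => y + s • ζ := by fun_prop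
    simpa using this.tendsto 0
  have hw1 := contDiffAt_dirDeriv ζ hw
  have hw2 := contDiffAt_dirDeriv ζ hw1
  have := derivs_of_tendsto_div_cube (φ := fun s : ℝ => w (y + s • ζ))
    (φ₁ := fun s : ℝ => dirDeriv ζ w (y + s • ζ))
    (φ₂ := fun s : ℝ => dirDeriv ζ (dirDeriv ζ w) (y + s • ζ))
    (k := dirDeriv ζ (dirDeriv ζ (dirDeriv ζ w)) (y + (0 : ℝ) • ζ)) (l := l)
    (by filter_upwards [hc.eventually (eventually_differentiableAt hw)] with s hs
        exact hasDerivAt_line ζ s hs)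
    (by filter_upwards [hc.eventually (eventually_differentiableAt hw1)] with s hs
        exact hasDerivAt_line ζ s hs)
    (hasDerivAt_line ζ 0 (by simpa using differentiableAt_of_smooth hw2))
    hl
  simpa using this

/-- Polarization: the mixed third derivative from the cubic leading term. -/
theorem jet_of_cubic_asymptotics {w : ℝ × ℝ → ℝ} {y : ℝ × ℝ} (hw : ContDiffAt ℝ ∞ w y)
    {C : ℝ × ℝ → ℝ}
    (hC : ∀ ζ, Tendsto (fun s : ℝ => w (y + s • ζ) / s ^ 3) (𝓝[≠] 0) (𝓝 (C ζ))) :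
    w y = 0 ∧ dt w y = 0 ∧ dx w y = 0 ∧
      dt (dx (dx w)) y = C (1, 1) + C (1, -1) - 2 * C (1, 0) := by
  refine ⟨(derivs_of_tendsto_div_cube_line hw 0 (hC 0)).1,
    (derivs_of_tendsto_div_cube_line hw _ (hC (1, 0))).2.1,
    (derivs_of_tendsto_div_cube_line hw _ (hC (0, 1))).2.1, ?_⟩
  rw [dx_eq_dirDeriv, dx_eq_dirDeriv, dt_eq_dirDeriv]
  set a : ℝ × ℝ := (1, 0)
  set b : ℝ × ℝ := (0, 1)
  -- Adding the values at k = 1 and k = -1 and subtracting twice the value at k = 0 leaves six times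
  -- the txx derivative; each third derivative along a line is 6 times the cubic limit, so the
  -- factors 6 cancel.
  have expand : ∀ k : ℝ, dirDeriv (a + k • b) (dirDeriv (a + k • b) (dirDeriv (a + k • b) w)) y =
      dirDeriv a (dirDeriv a (dirDeriv a w)) y
        + 3 * k * dirDeriv b (dirDeriv a (dirDeriv a w)) y
        + 3 * k ^ 2 * dirDeriv a (dirDeriv b (dirDeriv b w)) y
        + k ^ 3 * dirDeriv b (dirDeriv b (dirDeriv b w)) y := by
    intro k
    have sm : ∀ c d : ℝ × ℝ, ContDiffAt ℝ ∞ (dirDeriv c (dirDeriv d w)) y := fun c d =>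
      contDiffAt_dirDeriv _ (contDiffAt_dirDeriv _ hw)
    have s1 : ∀ c, ContDiffAt ℝ ∞ (dirDeriv c w) y := fun c => contDiffAt_dirDeriv _ hw
    have lin1 : dirDeriv (a + k • b) w = fun q => dirDeriv a w q + k * dirDeriv b w q := by
      funext q; exact dirDeriv_add_smul a b k q
    have kc : ∀ {B : ℝ × ℝ → ℝ} (e : ℝ × ℝ), ContDiffAt ℝ ∞ B y →
        dirDeriv e (fun q => k * B q) =ᶠ[𝓝 y] fun q => k * dirDeriv e B q := by
      intro B e hB
      filter_upwards [eventually_differentiableAt hB] with q hq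
      simp [dirDeriv, fderiv_const_mul hq]
    have sumrule : ∀ {A B : ℝ × ℝ → ℝ} (e : ℝ × ℝ), ContDiffAt ℝ ∞ A y → ContDiffAt ℝ ∞ B y →
        dirDeriv e (fun q => A q + k * B q) =ᶠ[𝓝 y]
          fun q => dirDeriv e A q + k * dirDeriv e B q := by
      intro A B e hA hB
      filter_upwards [dirDeriv_add e hA (contDiffAt_const.mul hB : ContDiffAt ℝ ∞
        (fun q => k * B q) y), kc e hB] with q h1 h2
      rw [h1, h2]
    have lin2 : dirDeriv (a + k • b) (dirDeriv (a + k • b) w) =ᶠ[𝓝 y] fun q =>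
        (dirDeriv a (dirDeriv a w) q + k * dirDeriv b (dirDeriv a w) q) +
          k * (dirDeriv a (dirDeriv b w) q + k * dirDeriv b (dirDeriv b w) q) := by
      rw [lin1]
      filter_upwards [sumrule (a + k • b) (s1 a) (s1 b)] with q hq
      rw [hq, dirDeriv_add_smul, dirDeriv_add_smul]
    have sA : ∀ c, ContDiffAt ℝ ∞ (fun q => dirDeriv a (dirDeriv c w) q +
        k * dirDeriv b (dirDeriv c w) q) y := fun c => (sm a c).add (contDiffAt_const.mul (sm b c))
    have c1 : ∀ c d : ℝ × ℝ, ∀ e : ℝ × ℝ, dirDeriv e (dirDeriv c (dirDeriv d w)) y =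
        dirDeriv e (dirDeriv d (dirDeriv c w)) y := fun c d e =>
      (dirDeriv_congr e (dirDeriv_comm_eventually c d hw)).self_of_nhds
    have c2 : ∀ c d e : ℝ × ℝ, dirDeriv e (dirDeriv c (dirDeriv d w)) y =
        dirDeriv c (dirDeriv e (dirDeriv d w)) y := fun c d e => dirDeriv_comm e c (s1 d)
    rw [(dirDeriv_congr (a + k • b) lin2).self_of_nhds,
      (sumrule (a + k • b) (sA a) (sA b)).self_of_nhds]
    beta_reduce
    rw [(sumrule (a + k • b) (sm a a) (sm b a)).self_of_nhds,
      (sumrule (a + k • b) (sm a b) (sm b b)).self_of_nhds]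
    simp only [dirDeriv_add_smul]
    rw [c1 a b a, c2 b a a, c2 b b a, c1 b a b, c2 a b b]
    ring
  have h0 := (derivs_of_tendsto_div_cube_line hw _ (hC (1, 0))).2.2
  have h1 := (derivs_of_tendsto_div_cube_line hw _ (hC (1, 1))).2.2
  have h2 := (derivs_of_tendsto_div_cube_line hw _ (hC (1, -1))).2.2
  have e1 : ((1, 1) : ℝ × ℝ) = a + (1 : ℝ) • b := by simp [a, b]
  have e2 : ((1, -1) : ℝ × ℝ) = a + (-1 : ℝ) • b := by simp [a, b]
  rw [e1, expand] at h1
  rw [e2, expand] at h2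
  rw [e1, e2]
  linarith

end Calculus

/-! ### Chain rule along the graph of a function. -/

/-- The partial derivative with respect to `t` on the space of `(t, x, u)`. -/
noncomputable abbrev pt (A : TXU → ℝ) : TXU → ℝ := dirDeriv (1, 0, 0) A

/-- The partial derivative with respect to `x` on the space of `(t, x, u)`. -/
noncomputable abbrev px (A : TXU → ℝ) : TXU → ℝ := dirDeriv (0, 1, 0) A

/-- The partial derivative with respect to `u` on the space of `(t, x, u)`. -/
noncomputable abbrev pu (A : TXU → ℝ) : TXU → ℝ := dirDeriv (0, 0, 1) A

theorem fderiv_eq_partials (A : TXU → ℝ) (z : TXU) (a b c : ℝ) :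
    fderiv ℝ A z (a, b, c) = a * pt A z + b * px A z + c * pu A z := by
  have : ((a, b, c) : TXU) = a • (1, 0, 0) + b • (0, 1, 0) + c • (0, 0, 1) := by simp
  rw [this]
  simp only [map_add, map_smul, smul_eq_mul, dirDeriv]

theorem fderiv_eq_dt_dx (v : ℝ × ℝ → ℝ) (y : ℝ × ℝ) (a b : ℝ) :
    fderiv ℝ v y (a, b) = a * dt v y + b * dx v y := by
  have : ((a, b) : ℝ × ℝ) = a • (1, 0) + b • (0, 1) := by simp
  rw [this]
  simp only [map_add, map_smul, smul_eq_mul, dt, dx]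

theorem det_prod_eq (L : ℝ × ℝ →L[ℝ] ℝ × ℝ) :
    L.det = (L (1, 0)).1 * (L (0, 1)).2 - (L (0, 1)).1 * (L (1, 0)).2 := by
  rw [ContinuousLinearMap.det, ← LinearMap.det_toMatrix (Module.Basis.finTwoProd ℝ),
    Matrix.det_fin_two]
  simp [LinearMap.toMatrix_apply]

theorem contDiffAt_graphPoint {u : ℝ × ℝ → ℝ} {p : ℝ × ℝ} (hu : ContDiffAt ℝ ∞ u p) :
    ContDiffAt ℝ ∞ (graphPoint u) p :=
  contDiffAt_fst.prodMk (contDiffAt_snd.prodMk hu)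

theorem hasFDerivAt_graphPoint {u : ℝ × ℝ → ℝ} {p : ℝ × ℝ} (hu : DifferentiableAt ℝ u p) :
    HasFDerivAt (graphPoint u) ((ContinuousLinearMap.fst ℝ ℝ ℝ).prod
      ((ContinuousLinearMap.snd ℝ ℝ ℝ).prod (fderiv ℝ u p))) p :=
  hasFDerivAt_fst.prodMk (hasFDerivAt_snd.prodMk hu.hasFDerivAt)

theorem dt_comp_graphPoint {A : TXU → ℝ} {u : ℝ × ℝ → ℝ} {p : ℝ × ℝ}
    (hA : DifferentiableAt ℝ A (graphPoint u p)) (hu : DifferentiableAt ℝ u p) :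
    dt (fun q => A (graphPoint u q)) p =
      pt A (graphPoint u p) + pu A (graphPoint u p) * dt u p := by
  have h := hA.hasFDerivAt.comp p (hasFDerivAt_graphPoint hu)
  rw [dt, show fderiv ℝ (fun q => A (graphPoint u q)) p = _ from h.fderiv]
  change fderiv ℝ A _ (1, 0, dt u p) = _
  rw [fderiv_eq_partials]
  ring

theorem dx_comp_graphPoint {A : TXU → ℝ} {u : ℝ × ℝ → ℝ} {p : ℝ × ℝ}
    (hA : DifferentiableAt ℝ A (graphPoint u p)) (hu : DifferentiableAt ℝ u p) :
    dx (fun q => A (graphPoint u q)) p =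
      px A (graphPoint u p) + pu A (graphPoint u p) * dx u p := by
  have h := hA.hasFDerivAt.comp p (hasFDerivAt_graphPoint hu)
  rw [dx, show fderiv ℝ (fun q => A (graphPoint u q)) p = _ from h.fderiv]
  change fderiv ℝ A _ (0, 1, dx u p) = _
  rw [fderiv_eq_partials]
  ring

theorem dirDeriv_comp_pair {v a b : ℝ × ℝ → ℝ} {p : ℝ × ℝ} (e : ℝ × ℝ)
    (hv : DifferentiableAt ℝ v (a p, b p)) (ha : DifferentiableAt ℝ a p)
    (hb : DifferentiableAt ℝ b p) :
    dirDeriv e (fun q => v (a q, b q)) p =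
      dt v (a p, b p) * dirDeriv e a p + dx v (a p, b p) * dirDeriv e b p := by
  have h := hv.hasFDerivAt.comp (f := fun q => (a q, b q)) p
    (ha.hasFDerivAt.prodMk hb.hasFDerivAt)
  rw [dirDeriv, show fderiv ℝ (fun q => v (a q, b q)) p = _ from h.fderiv]
  change fderiv ℝ v _ (dirDeriv e a p, dirDeriv e b p) = _
  rw [fderiv_eq_dt_dx]
  ring

section Transformation

variable {Φ : TXU → TXU} {u : ℝ × ℝ → ℝ} {p : ℝ × ℝ}

theorem contDiffAt_fst_comp {z : TXU} (hΦ : ContDiffAt ℝ ∞ Φ z) :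
    ContDiffAt ℝ ∞ (fun y => (Φ y).1) z := contDiffAt_fst.comp z hΦ

theorem contDiffAt_snd_fst_comp {z : TXU} (hΦ : ContDiffAt ℝ ∞ Φ z) :
    ContDiffAt ℝ ∞ (fun y => (Φ y).2.1) z :=
  contDiffAt_fst.comp z (contDiffAt_snd.comp z hΦ)

theorem contDiffAt_snd_snd_comp {z : TXU} (hΦ : ContDiffAt ℝ ∞ Φ z) :
    ContDiffAt ℝ ∞ (fun y => (Φ y).2.2) z :=
  contDiffAt_snd.comp z (contDiffAt_snd.comp z hΦ)

theorem fderiv_eq_triple {z : TXU} (hΦ : DifferentiableAt ℝ Φ z) (w : TXU) :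
    fderiv ℝ Φ z w = (fderiv ℝ (fun y => (Φ y).1) z w, fderiv ℝ (fun y => (Φ y).2.1) z w,
      fderiv ℝ (fun y => (Φ y).2.2) z w) := by
  have h1 := hΦ.hasFDerivAt.fst
  have h2 := hΦ.hasFDerivAt.snd.fst
  have h3 := hΦ.hasFDerivAt.snd.snd
  rw [h1.fderiv, h2.fderiv, h3.fderiv]
  rfl

theorem contDiffAt_newBase (hΦ : ContDiffAt ℝ ∞ Φ (graphPoint u p)) (hu : ContDiffAt ℝ ∞ u p) :
    ContDiffAt ℝ ∞ (newBase Φ u) p :=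
  ((contDiffAt_fst_comp hΦ).comp p (contDiffAt_graphPoint hu)).prodMk
    ((contDiffAt_snd_fst_comp hΦ).comp p (contDiffAt_graphPoint hu))

theorem fderiv_newBase (hΦ : ContDiffAt ℝ ∞ Φ (graphPoint u p)) (hu : ContDiffAt ℝ ∞ u p)
    (w : ℝ × ℝ) :
    fderiv ℝ (newBase Φ u) p w = (fderiv ℝ (fun q => (Φ (graphPoint u q)).1) p w,
      fderiv ℝ (fun q => (Φ (graphPoint u q)).2.1) p w) := by
  have h := differentiableAt_of_smooth (contDiffAt_newBase hΦ hu)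
  have h1 := h.hasFDerivAt.fst
  have h2 := h.hasFDerivAt.snd
  rw [show fderiv ℝ (fun q => (Φ (graphPoint u q)).1) p = _ from h1.fderiv,
    show fderiv ℝ (fun q => (Φ (graphPoint u q)).2.1) p = _ from h2.fderiv]
  rfl

theorem fderiv_newBase_dt (hΦ : ContDiffAt ℝ ∞ Φ (graphPoint u p)) (hu : ContDiffAt ℝ ∞ u p) :
    fderiv ℝ (newBase Φ u) p (1, 0) =
      (pt (fun y => (Φ y).1) (graphPoint u p) + pu (fun y => (Φ y).1) (graphPoint u p) * dt u p,
       pt (fun y => (Φ y).2.1) (graphPoint u p)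
        + pu (fun y => (Φ y).2.1) (graphPoint u p) * dt u p) := by
  rw [fderiv_newBase hΦ hu,
    ← dt_comp_graphPoint (A := fun y => (Φ y).1) (differentiableAt_of_smooth
      (contDiffAt_fst_comp hΦ)) (differentiableAt_of_smooth hu),
    ← dt_comp_graphPoint (A := fun y => (Φ y).2.1) (differentiableAt_of_smooth
      (contDiffAt_snd_fst_comp hΦ)) (differentiableAt_of_smooth hu)]
  rfl

theorem fderiv_newBase_dx (hΦ : ContDiffAt ℝ ∞ Φ (graphPoint u p)) (hu : ContDiffAt ℝ ∞ u p) :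
    fderiv ℝ (newBase Φ u) p (0, 1) =
      (px (fun y => (Φ y).1) (graphPoint u p) + pu (fun y => (Φ y).1) (graphPoint u p) * dx u p,
       px (fun y => (Φ y).2.1) (graphPoint u p)
        + pu (fun y => (Φ y).2.1) (graphPoint u p) * dx u p) := by
  rw [fderiv_newBase hΦ hu,
    ← dx_comp_graphPoint (A := fun y => (Φ y).1) (differentiableAt_of_smooth
      (contDiffAt_fst_comp hΦ)) (differentiableAt_of_smooth hu),
    ← dx_comp_graphPoint (A := fun y => (Φ y).2.1) (differentiableAt_of_smooth
      (contDiffAt_snd_fst_comp hΦ)) (differentiableAt_of_smooth hu)]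
  rfl

end Transformation

/-! ### Transforms of functions, and their response to cubic perturbations. -/

/-- A continuous linear equivalence from the nonvanishing of the determinant. -/
theorem exists_equiv_of_det_ne_zero {E : Type*} [NormedAddCommGroup E] [NormedSpace ℝ E]
    [FiniteDimensional ℝ E] (L : E →L[ℝ] E) (hL : L.det ≠ 0) :
    ∃ Le : E ≃L[ℝ] E, (Le : E →L[ℝ] E) = L := by
  refine ⟨(LinearMap.equivOfDetNeZero (L : E →ₗ[ℝ] E) hL).toContinuousLinearEquiv, ?_⟩
  ext w
  rfl

theorem det_ne_zero_of_injective {E : Type*} [NormedAddCommGroup E] [NormedSpace ℝ E]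
    [FiniteDimensional ℝ E] (L : E →L[ℝ] E) (hL : ∀ w, L w = 0 → w = 0) : L.det ≠ 0 := by
  intro h
  have := LinearMap.bot_lt_ker_of_det_eq_zero (f := (L : E →ₗ[ℝ] E)) h
  rw [LinearMap.ker_eq_bot'.2 hL] at this
  exact lt_irrefl _ this

/-- A smooth local right inverse, by the inverse function theorem. -/
theorem exists_local_inverse {E : Type*} [NormedAddCommGroup E] [NormedSpace ℝ E]
    [CompleteSpace E] {N : E → E} {p : E} (hN : ContDiffAt ℝ ∞ N p) (Le : E ≃L[ℝ] E)
    (hLe : HasFDerivAt N (Le : E →L[ℝ] E) p) :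
    ∃ S : E → E, ContDiffAt ℝ ∞ S (N p) ∧ S (N p) = p ∧ (∀ᶠ y in 𝓝 (N p), N (S y) = y) ∧
      (∀ᶠ q in 𝓝 p, S (N q) = q) ∧ HasFDerivAt S (Le.symm : E →L[ℝ] E) (N p) := by
  have hs : HasStrictFDerivAt N (Le : E →L[ℝ] E) p := hN.hasStrictFDerivAt' hLe (by simp)
  refine ⟨hs.localInverse N Le p, hN.to_localInverse hLe (by simp), hs.localInverse_apply_image,
    hs.eventually_right_inverse, hs.eventually_left_inverse, hs.to_localInverse.hasFDerivAt⟩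

/-- On the graph of `u` the pair (T, X) has a smooth local inverse; composing `U` along the graph
with it gives `v`. -/
theorem exists_transformsAt {Φ : TXU → TXU} {u : ℝ × ℝ → ℝ} {p : ℝ × ℝ}
    (hΦ : ContDiffAt ℝ ∞ Φ (graphPoint u p)) (hu : ContDiffAt ℝ ∞ u p)
    (hdet : (fderiv ℝ (newBase Φ u) p).det ≠ 0) : ∃ v, TransformsAt Φ u v p := by
  have hN := contDiffAt_newBase hΦ hu
  obtain ⟨Le, hLe⟩ := exists_equiv_of_det_ne_zero _ hdet
  have hd : HasFDerivAt (newBase Φ u) (Le : ℝ × ℝ →L[ℝ] ℝ × ℝ) p :=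
    hLe ▸ (differentiableAt_of_smooth hN).hasFDerivAt
  obtain ⟨S, hS, hSp, -, hl, -⟩ := exists_local_inverse hN Le hd
  refine ⟨fun y => (Φ (graphPoint u (S y))).2.2, hu, ?_, hdet, ?_⟩
  · have h1 : ContDiffAt ℝ ∞ (fun q => (Φ (graphPoint u q)).2.2) p :=
      (contDiffAt_snd_snd_comp hΦ).comp p (contDiffAt_graphPoint hu)
    exact ContDiffAt.comp (g := fun q => (Φ (graphPoint u q)).2.2) (newBase Φ u p)
      (by rwa [hSp]) hS
  · filter_upwards [hl] with q hq
    rw [hq]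

/-- Adding to `u` a form of degree three changes its transform, to leading order, by a nonzero
multiple of the transformed form. -/
theorem exists_cubic_asymptotics {Φ : TXU → TXU} {u v v' : ℝ × ℝ → ℝ} {p : ℝ × ℝ}
    {K : ℝ × ℝ → ℝ} (hΦ : ContDiffAt ℝ ∞ Φ (graphPoint u p))
    (hdetΦ : (fderiv ℝ Φ (graphPoint u p)).det ≠ 0)
    (hK : ContDiff ℝ ∞ K) (hKs : ∀ (s : ℝ) ζ, K (s • ζ) = s ^ 3 * K ζ) (hK0 : fderiv ℝ K 0 = 0)
    (Le : (ℝ × ℝ) ≃L[ℝ] ℝ × ℝ)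
    (hLe : (Le : ℝ × ℝ →L[ℝ] ℝ × ℝ) = fderiv ℝ (newBase Φ u) p)
    (h : TransformsAt Φ u v p) (h' : TransformsAt Φ (fun q => u q + K (q - p)) v' p) :
    newBase Φ (fun q => u q + K (q - p)) p = newBase Φ u p ∧
    ∃ κ : ℝ, κ ≠ 0 ∧ ∀ ζ, Tendsto (fun s : ℝ => (v' (newBase Φ u p + s • ζ) -
      v (newBase Φ u p + s • ζ)) / s ^ 3) (𝓝[≠] 0) (𝓝 (κ * K (Le.symm ζ))) := by
  obtain ⟨hu, hv, -, hvU⟩ := h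
  obtain ⟨hu', hv', -, hvU'⟩ := h'
  set u' : ℝ × ℝ → ℝ := fun q => u q + K (q - p) with hu'_def
  have hK00 : K 0 = 0 := by simpa using hKs 0 0
  have hup : u' p = u p := by simp [hu'_def, hK00]
  have hgp : graphPoint u' p = graphPoint u p := by simp [graphPoint, hup]
  have hNp : newBase Φ u' p = newBase Φ u p := by simp [newBase, hgp]
  refine ⟨hNp, ?_⟩
  set z := graphPoint u p with hz
  set y := newBase Φ u p with hy
  have hu'd : fderiv ℝ u' p = fderiv ℝ u p := by
    have h1 : HasFDerivAt (fun q => K (q - p)) (0 : ℝ × ℝ →L[ℝ] ℝ) p := by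
      have h2 : HasFDerivAt K (0 : ℝ × ℝ →L[ℝ] ℝ) (p - p) := by
        rw [sub_self, ← hK0]
        exact (hK.differentiable (by simp)).differentiableAt.hasFDerivAt
      have h3 := HasFDerivAt.comp (f := fun q => q - p) p h2 ((hasFDerivAt_id p).sub_const p)
      rwa [ContinuousLinearMap.zero_comp] at h3
    rw [hu'_def, ((differentiableAt_of_smooth hu).hasFDerivAt.fun_add h1).fderiv, add_zero]
  have hLe' : (Le : ℝ × ℝ →L[ℝ] ℝ × ℝ) = fderiv ℝ (newBase Φ u') p := by
    have a1 := fderiv_newBase_dt hΦ hu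
    have a2 := fderiv_newBase_dx hΦ hu
    have b1 := fderiv_newBase_dt (u := u') (p := p) (by rwa [hgp]) hu'
    have b2 := fderiv_newBase_dx (u := u') (p := p) (by rwa [hgp]) hu'
    rw [hgp, dt, hu'd, ← dt, ← a1] at b1
    rw [hgp, dx, hu'd, ← dx, ← a2] at b2
    rw [hLe]
    ext <;> simp [b1, b2]
  have hN' := contDiffAt_newBase (u := u') (p := p) (by rwa [hgp]) hu'
  obtain ⟨S, hS, hSp, hr, -, hSd⟩ := exists_local_inverse hN' Le
    (hLe' ▸ (differentiableAt_of_smooth hN').hasFDerivAt)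
  rw [hNp] at hS hSp hr hSd
  -- `D` vanishes on the graph of `u`, and on the graph of `u'` it equals v' - v at the transformed
  -- point. As the two graphs differ by `K` in the u-direction, v' - v is `K` times κ = D_u to
  -- leading order.
  set D : TXU → ℝ := fun w => (Φ w).2.2 - v ((Φ w).1, (Φ w).2.1) with hD
  have hDs : ContDiffAt ℝ ∞ D z := (contDiffAt_snd_snd_comp hΦ).sub
    (ContDiffAt.comp z (g := v) (f := fun w => ((Φ w).1, (Φ w).2.1)) hv
      ((contDiffAt_fst_comp hΦ).prodMk (contDiffAt_snd_fst_comp hΦ)))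
  have hDd := differentiableAt_of_smooth hDs
  have hDu : ∀ᶠ q in 𝓝 p, D (graphPoint u q) = 0 := by
    filter_upwards [hvU] with q hq
    exact sub_eq_zero.2 hq.symm
  refine ⟨pu D z, ?_, ?_⟩
  -- The derivatives of `D` along the graph of `u` are zero, so D_u = 0 would make dD = 0. But dD
  -- takes the value 1 on the vector that dΦ sends to (0, 0, 1).
  · intro hκ
    have e0 : (fun q => D (graphPoint u q)) =ᶠ[𝓝 p] fun _ => 0 := hDu
    have ht := dt_comp_graphPoint hDd (differentiableAt_of_smooth hu)
    have hx := dx_comp_graphPoint hDd (differentiableAt_of_smooth hu)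
    rw [dt, e0.fderiv_eq] at ht
    rw [dx, e0.fderiv_eq] at hx
    simp only [← hz, hκ, zero_mul, add_zero, fderiv_const_apply,
      zero_apply] at ht hx
    obtain ⟨Ψ, hΨ⟩ := exists_equiv_of_det_ne_zero _ hdetΦ
    have hΦd := differentiableAt_of_smooth hΦ
    have hw : fderiv ℝ Φ z (Ψ.symm (0, 0, 1)) = (0, 0, 1) := by
      rw [← hΨ]; simp
    have hD1 : HasFDerivAt D ((fderiv ℝ (fun w => (Φ w).2.2) z) - (fderiv ℝ v y).comp
        ((fderiv ℝ (fun w => (Φ w).1) z).prod (fderiv ℝ (fun w => (Φ w).2.1) z))) z :=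
      (differentiableAt_of_smooth (contDiffAt_snd_snd_comp hΦ)).hasFDerivAt.sub
        (HasFDerivAt.comp (f := fun w => ((Φ w).1, (Φ w).2.1)) (g := v) z
          (differentiableAt_of_smooth hv).hasFDerivAt
          ((differentiableAt_of_smooth (contDiffAt_fst_comp hΦ)).hasFDerivAt.prodMk
            (differentiableAt_of_smooth (contDiffAt_snd_fst_comp hΦ)).hasFDerivAt))
    have h0 : fderiv ℝ D z (Ψ.symm (0, 0, 1)) = 0 := by
      obtain ⟨a, b, c⟩ := Ψ.symm (0, 0, 1)
      rw [fderiv_eq_partials, ← ht, ← hx, hκ]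
      ring
    rw [hD1.fderiv] at h0
    rw [fderiv_eq_triple hΦd] at hw
    simp only [Prod.mk.injEq] at hw
    simp [hw.1, hw.2.1, hw.2.2, Prod.mk_zero_zero] at h0
  · intro ζ
    have hline : Tendsto (fun s : ℝ => y + s • ζ) (𝓝 0) (𝓝 y) := by
      have : Continuous fun s : ℝ => y + s • ζ := by fun_prop
      simpa using this.tendsto 0
    have hSl : HasDerivAt (fun s : ℝ => S (y + s • ζ)) (Le.symm ζ) 0 := by
      have h1 : HasDerivAt (fun r : ℝ => y + r • ζ) ζ 0 := by
        simpa using ((hasDerivAt_id (0 : ℝ)).smul_const ζ).const_add y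
      have h2 : HasFDerivAt S (Le.symm : ℝ × ℝ →L[ℝ] ℝ × ℝ) (y + (0 : ℝ) • ζ) := by simpa using hSd
      exact h2.comp_hasDerivAt (0 : ℝ) h1
    have hq : Tendsto (fun s : ℝ => S (y + s • ζ)) (𝓝 0) (𝓝 p) := by
      have := hSl.continuousAt.tendsto
      simpa [hSp] using this
    have hslope : Tendsto (fun s : ℝ => s⁻¹ • (S (y + s • ζ) - p)) (𝓝[≠] 0) (𝓝 (Le.symm ζ)) := by
      have := hSl.tendsto_slope
      refine this.congr fun s => ?_
      simp [slope_def_module, hSp]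
    have hK3 : Tendsto (fun s : ℝ => K (S (y + s • ζ) - p) / s ^ 3) (𝓝[≠] 0)
        (𝓝 (K (Le.symm ζ))) := by
      refine ((hK.continuous.tendsto _).comp hslope).congr' ?_
      filter_upwards [self_mem_nhdsWithin] with s hs
      simp only [Function.comp, hKs]
      rw [inv_pow]
      field_simp
    have hgc : Tendsto (graphPoint u) (𝓝 p) (𝓝 z) :=
      (contDiffAt_graphPoint hu).continuousAt
    have hgc' : Tendsto (graphPoint u') (𝓝 p) (𝓝 z) := by
      have := (contDiffAt_graphPoint hu').continuousAt.tendsto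
      rwa [hgp] at this
    -- Strict differentiability is required because both endpoints of the increment move with `s`.
    have hstrict := (hDs.hasStrictFDerivAt (by simp)).isLittleO
    have hlit := hstrict.comp_tendsto ((hgc'.comp hq).prodMk_nhds (hgc.comp hq))
    have hlit' := hlit.mono (nhdsWithin_le_nhds (s := {0}ᶜ))
    have hbig : (fun s : ℝ => graphPoint u' (S (y + s • ζ)) - graphPoint u (S (y + s • ζ)))
        =O[𝓝[≠] 0] fun s => s ^ 3 := by
      have h1 : (fun s : ℝ => K (S (y + s • ζ) - p)) =O[𝓝[≠] 0] fun s => s ^ 3 :=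
        Asymptotics.isBigO_of_div_tendsto_nhds
          (by filter_upwards [self_mem_nhdsWithin] with s hs h0
              exact absurd (pow_eq_zero_iff (by norm_num) |>.1 h0) hs) _ hK3
      refine Asymptotics.IsBigO.trans (Asymptotics.IsBigO.of_bound 1
        (Eventually.of_forall fun s => ?_)) h1
      simp [graphPoint, hu'_def]
    have hsmall := (hlit'.trans_isBigO hbig).tendsto_div_nhds_zero
    have hsum := hsmall.add (hK3.const_mul (pu D z))
    rw [zero_add] at hsum
    refine hsum.congr' ?_
    have ev : ∀ᶠ s : ℝ in 𝓝 0, newBase Φ u' (S (y + s • ζ)) = y + s • ζ ∧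
        D (graphPoint u (S (y + s • ζ))) = 0 ∧
        v' (newBase Φ u' (S (y + s • ζ))) = (Φ (graphPoint u' (S (y + s • ζ)))).2.2 := by
      filter_upwards [hline.eventually hr, hq.eventually hDu, hq.eventually hvU'] with s h1 h2 h3
      exact ⟨h1, h2, h3⟩
    filter_upwards [nhdsWithin_le_nhds ev] with s ⟨h1, h2, h3⟩
    have e1 : graphPoint u' (S (y + s • ζ)) - graphPoint u (S (y + s • ζ)) =
        (0, 0, K (S (y + s • ζ) - p)) := by
      simp [graphPoint, hu'_def]
    have e2 : D (graphPoint u' (S (y + s • ζ))) = v' (y + s • ζ) - v (y + s • ζ) := by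
      have : v ((Φ (graphPoint u' (S (y + s • ζ)))).1, (Φ (graphPoint u' (S (y + s • ζ)))).2.1)
          = v (y + s • ζ) := congrArg v h1
      rw [hD]
      simp only
      rw [this, ← h3, h1]
    simp only [Function.comp, e1, h2, e2, fderiv_eq_partials]
    ring

theorem third_jet_add {v w : ℝ × ℝ → ℝ} {y : ℝ × ℝ} (hv : ContDiffAt ℝ ∞ v y)
    (hw : ContDiffAt ℝ ∞ w y) :
    dt (fun q => v q + w q) y = dt v y + dt w y ∧ dx (fun q => v q + w q) y = dx v y + dx w y ∧
      dt (dx (dx fun q => v q + w q)) y = dt (dx (dx v)) y + dt (dx (dx w)) y := by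
  simp only [dt_eq_dirDeriv, dx_eq_dirDeriv]
  have h1 := dirDeriv_add (0, 1) hv hw
  have h2 := dirDeriv_add (0, 1) (contDiffAt_dirDeriv (0, 1) hv) (contDiffAt_dirDeriv (0, 1) hw)
  have h3 := dirDeriv_add (1, 0) (contDiffAt_dirDeriv (0, 1) (contDiffAt_dirDeriv (0, 1) hv))
    (contDiffAt_dirDeriv (0, 1) (contDiffAt_dirDeriv (0, 1) hw))
  refine ⟨(dirDeriv_add (1, 0) hv hw).self_of_nhds, h1.self_of_nhds, ?_⟩
  have h12 := (dirDeriv_congr (0, 1) h1).trans h2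
  rw [(dirDeriv_congr (1, 0) h12).self_of_nhds, h3.self_of_nhds]

/-- The equation is nonlinear only through u u_x, which does not notice a perturbation whose value
and first derivatives vanish at the point. -/
theorem Equation.holdsAt_add {θ : Equation} {v w : ℝ × ℝ → ℝ} {y : ℝ × ℝ}
    (hv : ContDiffAt ℝ ∞ v y) (hw : ContDiffAt ℝ ∞ w y) (h0 : w y = 0) (ht : dt w y = 0)
    (hx : dx w y = 0) (hvθ : θ.HoldsAt v y) :
    θ.HoldsAt (fun q => v q + w q) y ↔ θ.h y.1 * dt (dx (dx w)) y = 0 := by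
  obtain ⟨h1, h2, h3⟩ := third_jet_add hv hw
  unfold Equation.HoldsAt at *
  rw [h1, h2, h3, ht, hx]
  simp only [h0, add_zero]
  rw [mul_add, ← add_assoc, hvθ, zero_add]

/-- A form of degree three whose `t x²` coefficient vanishes, transformed by the inverse of the
derivative of `newBase Φ u`, again has vanishing `t x²` coefficient. -/
theorem MapsEquation.cubic_condition {Ω : Set TXU} {Φ : TXU → TXU} {θ θ' : Equation}
    (hΦ : IsPointTransformation Ω Φ) (hΩ : IsOpen Ω) (h : MapsEquation Ω Φ θ θ')
    {u : ℝ × ℝ → ℝ} {p : ℝ × ℝ} (hp : graphPoint u p ∈ Ω) (hu : ContDiffAt ℝ ∞ u p)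
    (hθ : θ.HoldsAt u p) (Le : (ℝ × ℝ) ≃L[ℝ] ℝ × ℝ)
    (hLe : (Le : ℝ × ℝ →L[ℝ] ℝ × ℝ) = fderiv ℝ (newBase Φ u) p)
    (hdet : (fderiv ℝ (newBase Φ u) p).det ≠ 0)
    {K : ℝ × ℝ → ℝ} (hK : ContDiff ℝ ∞ K) (hKs : ∀ (s : ℝ) ζ, K (s • ζ) = s ^ 3 * K ζ)
    (hK0 : K (1, 1) + K (1, -1) - 2 * K (1, 0) = 0) :
    K (Le.symm (1, 1)) + K (Le.symm (1, -1)) - 2 * K (Le.symm (1, 0)) = 0 := by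
  have hKasym : ∀ (r : ℝ × ℝ) (ζ : ℝ × ℝ), Tendsto (fun s : ℝ => K ((r + s • ζ) - r) / s ^ 3)
      (𝓝[≠] 0) (𝓝 (K ζ)) := by
    intro r ζ
    refine tendsto_const_nhds.congr' ?_
    filter_upwards [self_mem_nhdsWithin] with s hs
    have : s ≠ 0 := hs
    rw [add_sub_cancel_left, hKs]
    field_simp
  have hKp : ContDiffAt ℝ ∞ (fun q => K (q - p)) p :=
    (hK.comp (contDiff_id.sub contDiff_const)).contDiffAt
  obtain ⟨k0, kt, kx, ktxx⟩ := jet_of_cubic_asymptotics hKp (hKasym p)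
  have hKz : fderiv ℝ K 0 = 0 := by
    have hKs0 : ContDiffAt ℝ ∞ K 0 := hK.contDiffAt
    obtain ⟨-, at0, ax0, -⟩ := jet_of_cubic_asymptotics hKs0
      (C := K) (fun ζ => by simpa using hKasym 0 ζ)
    ext
    · simpa [dt] using at0
    · simpa [dx] using ax0
  set u' : ℝ × ℝ → ℝ := fun q => u q + K (q - p) with hu'
  have hu's : ContDiffAt ℝ ∞ u' p := hu.add hKp
  -- For a cubic form the combination in `hK0` is twice the tx² coefficient, which is the txx
  -- derivative.
  have hθu' : θ.HoldsAt u' p := by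
    rw [hu', Equation.holdsAt_add (w := fun q => K (q - p)) hu hKp k0 kt kx hθ, ktxx, hK0, mul_zero]
  have hz : ContDiffAt ℝ ∞ Φ (graphPoint u p) := hΦ.1.contDiffAt (hΩ.mem_nhds hp)
  have hup : u' p = u p := by simp only [hu', k0, add_zero]
  have hgp : graphPoint u' p = graphPoint u p := by simp [graphPoint, hup]
  have htd : dt u' p = dt u p := by rw [(third_jet_add hu hKp).1, kt, add_zero]
  have hxd : dx u' p = dx u p := by rw [(third_jet_add hu hKp).2.1, kx, add_zero]
  have hz' : ContDiffAt ℝ ∞ Φ (graphPoint u' p) := by rwa [hgp]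
  have hdet' : (fderiv ℝ (newBase Φ u') p).det ≠ 0 := by
    rw [det_prod_eq, fderiv_newBase_dt hz' hu's, fderiv_newBase_dx hz' hu's, hgp, htd, hxd,
      ← fderiv_newBase_dt hz hu, ← fderiv_newBase_dx hz hu, ← det_prod_eq]
    exact hdet
  obtain ⟨v, hv⟩ := exists_transformsAt hz hu hdet
  obtain ⟨v', hv'⟩ := exists_transformsAt hz' hu's hdet'
  obtain ⟨hN, κ, hκ, hasym⟩ := exists_cubic_asymptotics hz (hΦ.2 _ hp) hK hKs hKz Le hLe hv hv'
  have h1 := (h.2 u v p hp hv).1 hθ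
  have h2 := (h.2 u' v' p (by rwa [hgp]) hv').1 hθu'
  have hvs := hv.2.1
  have hvs' := hv'.2.1
  rw [hN] at h2 hvs'
  set y := newBase Φ u p
  have hws : ContDiffAt ℝ ∞ (fun q => v' q - v q) y := hvs'.sub hvs
  obtain ⟨w0, wt, wx, wtxx⟩ := jet_of_cubic_asymptotics hws hasym
  have h3 := (Equation.holdsAt_add (θ := θ') hvs hws w0 wt wx h1).1 (by simpa using h2)
  have hy : θ'.h y.1 ≠ 0 := fun h0 => θ'.gh_ne_zero y.1 (h.1 _ hp).2 (by rw [h0, mul_zero])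
  have h4 := (mul_eq_zero.1 h3).resolve_left hy
  rw [wtxx] at h4
  refine (mul_eq_zero.1 (?_ : κ * _ = 0)).resolve_left hκ
  linear_combination h4

/-- The derivative of the change of the independent variables is diagonal. -/
theorem MapsEquation.diagonal {Ω : Set TXU} {Φ : TXU → TXU} {θ θ' : Equation}
    (hΦ : IsPointTransformation Ω Φ) (hΩ : IsOpen Ω) (h : MapsEquation Ω Φ θ θ')
    {u : ℝ × ℝ → ℝ} {p : ℝ × ℝ} (hp : graphPoint u p ∈ Ω) (hu : ContDiffAt ℝ ∞ u p)
    (hθ : θ.HoldsAt u p) (hdet : (fderiv ℝ (newBase Φ u) p).det ≠ 0) :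
    (fderiv ℝ (newBase Φ u) p (1, 0)).2 = 0 ∧ (fderiv ℝ (newBase Φ u) p (0, 1)).1 = 0 := by
  obtain ⟨Le, hLe⟩ := exists_equiv_of_det_ne_zero _ hdet
  have key := fun (K : ℝ × ℝ → ℝ) hK hKs hK0 =>
    h.cubic_condition hΦ hΩ hp hu hθ Le hLe hdet (K := K) hK hKs hK0
  obtain ⟨a, b⟩ : ∃ a, a = Le.symm (1, 0) := ⟨_, rfl⟩
  have hb := b
  obtain ⟨c, d⟩ : ∃ c, c = Le.symm (0, 1) := ⟨_, rfl⟩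
  have e1 : Le.symm (1, 1) = a + c := by rw [hb, d, ← map_add]; simp
  have e2 : Le.symm (1, -1) = a - c := by rw [hb, d, ← map_sub]; simp
  have hac : a.1 * c.2 - c.1 * a.2 ≠ 0 := by
    intro h0
    have l1 : Le (c.2 • a - a.2 • c) = 0 := by
      have : c.2 • a - a.2 • c = 0 := by
        ext
        · simp; linarith
        · simp; ring
      rw [this, map_zero]
    have l2 : Le (c.1 • a - a.1 • c) = 0 := by
      have : c.1 • a - a.1 • c = 0 := by
        ext
        · simp; ring
        · simp; linarith
      rw [this, map_zero]
    rw [map_sub, map_smul, map_smul, hb, d] at l1 l2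
    simp at l1 l2
    rw [← hb, ← d] at l1 l2
    have : a = 0 := by ext <;> simp [l1, l2]
    rw [this] at hb
    have := congrArg (fun w => (Le w).1) hb
    simp at this
  -- t³, x³ and t²x span the cubic forms without tx² term. With `a`, `c` the columns of L⁻¹, the tx²
  -- coefficients of their transforms are 3a₁c₁², 3a₂c₂² and a₂c₁² + 2a₁c₁c₂.
  have k1 := key (fun q => q.1 ^ 3) (by fun_prop) (fun s ζ => by simp; ring) (by norm_num)
  have k2 := key (fun q => q.2 ^ 3) (by fun_prop) (fun s ζ => by simp; ring) (by norm_num)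
  have k3 := key (fun q => q.1 ^ 2 * q.2) (by fun_prop) (fun s ζ => by simp; ring) (by norm_num)
  rw [e1, e2, ← hb] at k1 k2 k3
  simp only [Prod.fst_add, Prod.snd_add, Prod.fst_sub, Prod.snd_sub] at k1 k2 k3
  have k1' : a.1 * c.1 ^ 2 = 0 := by linarith
  have k2' : a.2 * c.2 ^ 2 = 0 := by linarith
  have k3' : c.1 ^ 2 * a.2 + 2 * a.1 * c.1 * c.2 = 0 := by linarith
  have hc1 : c.1 = 0 := by
    by_contra hc
    have ha : a.1 = 0 := by
      rcases mul_eq_zero.1 k1' with h0 | h0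
      · exact h0
      · exact absurd (pow_eq_zero_iff (by norm_num) |>.1 h0) hc
    rw [ha] at k3' hac
    simp [hc] at k3'
    simp [k3'] at hac
  have hc2 : c.2 ≠ 0 := fun h0 => hac (by rw [h0, hc1]; ring)
  have ha2 : a.2 = 0 := by
    rcases mul_eq_zero.1 k2' with h0 | h0
    · exact h0
    · exact absurd (pow_eq_zero_iff (by norm_num) |>.1 h0) hc2
  have ha1 : a.1 ≠ 0 := fun h0 => hac (by rw [h0, hc1]; ring)
  have ea : a = a.1 • ((1, 0) : ℝ × ℝ) := by ext <;> simp [ha2]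
  have ec : c = c.2 • ((0, 1) : ℝ × ℝ) := by ext <;> simp [hc1]
  have la : a.1 • Le (1, 0) = (1, 0) := by rw [← map_smul, ← ea, hb]; simp
  have lc : c.2 • Le (0, 1) = (0, 1) := by rw [← map_smul, ← ec, d]; simp
  rw [← hLe]
  constructor
  · have := congrArg Prod.snd la
    simpa [ha1] using this
  · have := congrArg Prod.fst lc
    simpa [hc2] using this

/-! ### Polynomials with prescribed jets, and the form of T and X. -/

/-- The polynomial with prescribed derivatives at `p`. -/
noncomputable def jetPoly (p : ℝ × ℝ) (r a b c d e : ℝ) (q : ℝ × ℝ) : ℝ :=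
  r + a * (q.1 - p.1) + b * (q.2 - p.2) + c / 2 * (q.2 - p.2) ^ 2
    + d * ((q.1 - p.1) * (q.2 - p.2)) + e / 2 * ((q.1 - p.1) * (q.2 - p.2) ^ 2)

theorem contDiff_jetPoly (p : ℝ × ℝ) (r a b c d e : ℝ) : ContDiff ℝ ∞ (jetPoly p r a b c d e) := by
  unfold jetPoly
  fun_prop

theorem jetPoly_self (p : ℝ × ℝ) (r a b c d e : ℝ) : jetPoly p r a b c d e p = r := by
  simp [jetPoly]

theorem dt_eq_deriv {u : ℝ × ℝ → ℝ} {p : ℝ × ℝ} (hu : DifferentiableAt ℝ u p) {l : ℝ}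
    (h : HasDerivAt (fun s => u (s, p.2)) l p.1) : dt u p = l := by
  have h1 : HasDerivAt (fun s : ℝ => ((s, p.2) : ℝ × ℝ)) (1, 0) p.1 :=
    (hasDerivAt_id p.1).prodMk (hasDerivAt_const _ _)
  exact (hu.hasFDerivAt.comp_hasDerivAt (f := fun s : ℝ => ((s, p.2) : ℝ × ℝ)) p.1 h1).unique h

theorem dx_eq_deriv {u : ℝ × ℝ → ℝ} {p : ℝ × ℝ} (hu : DifferentiableAt ℝ u p) {l : ℝ}
    (h : HasDerivAt (fun s => u (p.1, s)) l p.2) : dx u p = l := by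
  have h1 : HasDerivAt (fun s : ℝ => ((p.1, s) : ℝ × ℝ)) (0, 1) p.2 :=
    (hasDerivAt_const _ _).prodMk (hasDerivAt_id p.2)
  exact (hu.hasFDerivAt.comp_hasDerivAt (f := fun s : ℝ => ((p.1, s) : ℝ × ℝ)) p.2 h1).unique h

theorem hasDerivAt_quadratic (α β γ y s : ℝ) :
    HasDerivAt (fun s => α + β * (s - y) + γ * (s - y) ^ 2) (β + 2 * γ * (s - y)) s := by
  have h := (hasDerivAt_id s).sub_const y
  refine (((h.const_mul β).const_add α).add ((h.pow 2).const_mul γ)).congr_deriv ?_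
  simp
  ring

theorem dx_jetPoly (p : ℝ × ℝ) (r a b c d e : ℝ) :
    dx (jetPoly p r a b c d e) = jetPoly p b d c 0 e 0 := by
  funext q
  refine dx_eq_deriv ((contDiff_jetPoly p r a b c d e).differentiable (by simp) q) ?_
  refine ((hasDerivAt_quadratic (r + a * (q.1 - p.1)) (b + d * (q.1 - p.1))
    (c / 2 + e / 2 * (q.1 - p.1)) p.2 q.2).congr_deriv ?_).congr_of_eventuallyEq
    (Eventually.of_forall fun s => ?_)
  · simp [jetPoly]; ring
  · simp [jetPoly]; ring

theorem dt_jetPoly (p : ℝ × ℝ) (r a b c d e : ℝ) : dt (jetPoly p r a b c d e) p = a := by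
  refine dt_eq_deriv ((contDiff_jetPoly p r a b c d e).differentiable (by simp) p) ?_
  refine ((hasDerivAt_quadratic r a 0 p.1 p.1).congr_deriv (by simp)).congr_of_eventuallyEq
    (Eventually.of_forall fun s => ?_)
  simp [jetPoly]

theorem graphPoint_jetPoly (t x r a b c d e : ℝ) :
    graphPoint (jetPoly (t, x) r a b c d e) (t, x) = (t, x, r) := by
  simp [graphPoint, jetPoly_self]

theorem holdsAt_jetPoly (θ : Equation) (t x r a b c d e : ℝ) :
    θ.HoldsAt (jetPoly (t, x) r a b c d e) (t, x) ↔
      a + θ.f t * b + θ.g t * r * b + θ.h t * e = 0 := by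
  simp [Equation.HoldsAt, dx_jetPoly, dt_jetPoly, jetPoly_self]

/-- The new independent variables: `T` depends on `t` only, and `X` depends on `x` only. -/
theorem MapsEquation.base_partials {Ω : Set TXU} {Φ : TXU → TXU} {θ θ' : Equation}
    (hΦ : IsPointTransformation Ω Φ) (hΩ : IsOpen Ω) (h : MapsEquation Ω Φ θ θ')
    {z : TXU} (hz : z ∈ Ω) :
    px (fun y => (Φ y).1) z = 0 ∧ pu (fun y => (Φ y).1) z = 0 ∧
      pt (fun y => (Φ y).2.1) z = 0 ∧ pu (fun y => (Φ y).2.1) z = 0 := by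
  obtain ⟨t, x, r⟩ := z
  have hs : ContDiffAt ℝ ∞ Φ (t, x, r) := hΦ.1.contDiffAt (hΩ.mem_nhds hz)
  set Tt := pt (fun y => (Φ y).1) (t, x, r)
  set Tx := px (fun y => (Φ y).1) (t, x, r)
  set Tu := pu (fun y => (Φ y).1) (t, x, r)
  set Xt := pt (fun y => (Φ y).2.1) (t, x, r)
  set Xx := px (fun y => (Φ y).2.1) (t, x, r)
  set Xu := pu (fun y => (Φ y).2.1) (t, x, r)
  have hθh : θ.h t ≠ 0 := fun h0 => θ.gh_ne_zero t (h.1 _ hz).1 (by rw [h0, mul_zero])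
  -- Any slopes u_t = a, u_x = b are attained by a function satisfying `θ` at the point: since h ≠
  -- 0, the equation is solved for u_txx.
  have key : ∀ a b, (Tt + Tu * a) * (Xx + Xu * b) - (Tx + Tu * b) * (Xt + Xu * a) ≠ 0 →
      Xt + Xu * a = 0 ∧ Tx + Tu * b = 0 := by
    intro a b hab
    set u := jetPoly (t, x) r a b 0 0 (-(a + θ.f t * b + θ.g t * r * b) / θ.h t)
    have hu : ContDiffAt ℝ ∞ u (t, x) := (contDiff_jetPoly _ _ _ _ _ _ _).contDiffAt
    have hg : graphPoint u (t, x) = (t, x, r) := graphPoint_jetPoly _ _ _ _ _ _ _ _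
    have ht : dt u (t, x) = a := dt_jetPoly _ _ _ _ _ _ _
    have hx : dx u (t, x) = b := by
      rw [show dx u = _ from dx_jetPoly _ _ _ _ _ _ _, jetPoly_self]
    have h1 := fderiv_newBase_dt (Φ := Φ) (u := u) (p := (t, x)) (by rwa [hg]) hu
    have h2 := fderiv_newBase_dx (Φ := Φ) (u := u) (p := (t, x)) (by rwa [hg]) hu
    rw [hg, ht] at h1
    rw [hg, hx] at h2
    have := h.diagonal hΦ hΩ (u := u) (p := (t, x)) (by rwa [hg]) hu
      ((holdsAt_jetPoly _ _ _ _ _ _ _ _ _).2 (by field_simp; ring))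
      (by rw [det_prod_eq, h1, h2]; exact hab)
    rwa [h1, h2] at this
  -- Degeneracy for the slopes (0,0), (1,0), (0,1) would annihilate all 2×2 minors of (dT, dX),
  -- against the invertibility of dΦ.
  have hne : ∃ a b, (Tt + Tu * a) * (Xx + Xu * b) - (Tx + Tu * b) * (Xt + Xu * a) ≠ 0 := by
    by_contra! hall
    have h00 := hall 0 0
    have h10 := hall 1 0
    have h01 := hall 0 1
    obtain ⟨Ψ, hΨ⟩ := exists_equiv_of_det_ne_zero _ (hΦ.2 _ hz)
    have hd := fderiv_eq_triple (differentiableAt_of_smooth hs)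
    have w1 : fderiv ℝ Φ (t, x, r) (Ψ.symm (1, 0, 0)) = (1, 0, 0) := by rw [← hΨ]; simp
    have w2 : fderiv ℝ Φ (t, x, r) (Ψ.symm (0, 1, 0)) = (0, 1, 0) := by rw [← hΨ]; simp
    generalize Ψ.symm (1, 0, 0) = e at w1
    generalize Ψ.symm (0, 1, 0) = e' at w2
    obtain ⟨a, b, c⟩ := e
    obtain ⟨a', b', c'⟩ := e'
    rw [hd] at w1 w2
    simp only [Prod.mk.injEq, fderiv_eq_partials] at w1 w2
    obtain ⟨p1, p2, -⟩ := w1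
    obtain ⟨q1, q2, -⟩ := w2
    change a * Tt + b * Tx + c * Tu = 1 at p1
    change a * Xt + b * Xx + c * Xu = 0 at p2
    change a' * Tt + b' * Tx + c' * Tu = 0 at q1
    change a' * Xt + b' * Xx + c' * Xu = 1 at q2
    have m1 : Tt * Xx - Tx * Xt = 0 := by linarith
    have m2 : Tu * Xx - Tx * Xu = 0 := by linarith
    have m3 : Tt * Xu - Tu * Xt = 0 := by linarith
    have : (a * Tt + b * Tx + c * Tu) * (a' * Xt + b' * Xx + c' * Xu) -
        (a' * Tt + b' * Tx + c' * Tu) * (a * Xt + b * Xx + c * Xu) = 0 := by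
      linear_combination (a * b' - a' * b) * m1 + (c * b' - c' * b) * m2 + (a * c' - a' * c) * m3
    rw [p1, p2, q1, q2] at this
    norm_num at this
  obtain ⟨a, b, hab⟩ := hne
  obtain ⟨k1, k2⟩ := key a b hab
  -- The determinant is affine in `b` and nonzero at `b`, so it is nonzero at b + 1 or at b - 1; two
  -- admissible slopes then separate T_x from T_u. The same works for X with `a`.
  have hTu : Tu = 0 := by
    by_cases h1 : (Tt + Tu * a) * (Xx + Xu * (b + 1)) - (Tx + Tu * (b + 1)) * (Xt + Xu * a) = 0
    · have := (key a (b - 1) fun h2 => hab (by linarith)).2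
      linarith
    · have := (key a (b + 1) h1).2
      linarith
  have hXu : Xu = 0 := by
    by_cases h1 : (Tt + Tu * (a + 1)) * (Xx + Xu * b) - (Tx + Tu * b) * (Xt + Xu * (a + 1)) = 0
    · have := (key (a - 1) b fun h2 => hab (by linarith)).1
      linarith
    · have := (key (a + 1) b h1).1
      linarith
  rw [hTu] at k2
  rw [hXu] at k1
  exact ⟨by linarith, hTu, by linarith, hXu⟩

/-! ### Total derivatives and the transformed jets. -/

theorem contDiffAt_pt {A : TXU → ℝ} {z : TXU} (hA : ContDiffAt ℝ ∞ A z) :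
    ContDiffAt ℝ ∞ (pt A) z := contDiffAt_dirDeriv _ hA

theorem contDiffAt_px {A : TXU → ℝ} {z : TXU} (hA : ContDiffAt ℝ ∞ A z) :
    ContDiffAt ℝ ∞ (px A) z := contDiffAt_dirDeriv _ hA

theorem contDiffAt_pu {A : TXU → ℝ} {z : TXU} (hA : ContDiffAt ℝ ∞ A z) :
    ContDiffAt ℝ ∞ (pu A) z := contDiffAt_dirDeriv _ hA

section Jets

variable {u : ℝ × ℝ → ℝ} {p : ℝ × ℝ}

theorem contDiffAt_comp_graphPoint {A : TXU → ℝ} (hA : ContDiffAt ℝ ∞ A (graphPoint u p))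
    (hu : ContDiffAt ℝ ∞ u p) : ContDiffAt ℝ ∞ (fun q => A (graphPoint u q)) p :=
  hA.comp p (contDiffAt_graphPoint hu)

theorem dt_comp_graphPoint_eventually {A : TXU → ℝ} (hA : ContDiffAt ℝ ∞ A (graphPoint u p))
    (hu : ContDiffAt ℝ ∞ u p) : dt (fun q => A (graphPoint u q)) =ᶠ[𝓝 p]
      fun q => pt A (graphPoint u q) + pu A (graphPoint u q) * dt u q := by
  have hc : Tendsto (graphPoint u) (𝓝 p) (𝓝 (graphPoint u p)) :=
    (contDiffAt_graphPoint hu).continuousAt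
  filter_upwards [hc.eventually (eventually_differentiableAt hA),
    eventually_differentiableAt hu] with q h1 h2
  exact dt_comp_graphPoint h1 h2

theorem dx_comp_graphPoint_eventually {A : TXU → ℝ} (hA : ContDiffAt ℝ ∞ A (graphPoint u p))
    (hu : ContDiffAt ℝ ∞ u p) : dx (fun q => A (graphPoint u q)) =ᶠ[𝓝 p]
      fun q => px A (graphPoint u q) + pu A (graphPoint u q) * dx u q := by
  have hc : Tendsto (graphPoint u) (𝓝 p) (𝓝 (graphPoint u p)) :=
    (contDiffAt_graphPoint hu).continuousAt
  filter_upwards [hc.eventually (eventually_differentiableAt hA),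
    eventually_differentiableAt hu] with q h1 h2
  exact dx_comp_graphPoint h1 h2

/-- The total derivative `D_t D_x` of a function of `(t, x, u)`. -/
theorem dt_dx_comp_graphPoint {A : TXU → ℝ} (hA : ContDiffAt ℝ ∞ A (graphPoint u p))
    (hu : ContDiffAt ℝ ∞ u p) :
    dt (dx fun q => A (graphPoint u q)) p =
      pt (px A) (graphPoint u p) + pu (px A) (graphPoint u p) * dt u p
        + (pt (pu A) (graphPoint u p) + pu (pu A) (graphPoint u p) * dt u p) * dx u p
        + pu A (graphPoint u p) * dt (dx u) p := by
  have hx := contDiffAt_px hA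
  have hU := contDiffAt_pu hA
  have hxu : ContDiffAt ℝ ∞ (dx u) p := contDiffAt_dirDeriv (0, 1) hu
  have gx := contDiffAt_comp_graphPoint hx hu
  have gU := contDiffAt_comp_graphPoint hU hu
  have h1 := dirDeriv_congr (1, 0) (dx_comp_graphPoint_eventually hA hu)
  have h2 := dirDeriv_add (1, 0) gx (gU.mul hxu)
  have h3 := dirDeriv_mul (1, 0) gU hxu
  have h4 := dt_comp_graphPoint_eventually hx hu
  have h5 := dt_comp_graphPoint_eventually hU hu
  have e1 := h1.self_of_nhds
  have e2 := h2.self_of_nhds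
  have e3 := h3.self_of_nhds
  have e4 := h4.self_of_nhds
  have e5 := h5.self_of_nhds
  simp only [dt_eq_dirDeriv] at *
  rw [e1, e2, e3, e4, e5]
  ring

/-- The total derivative `D_t D_x D_x` of a function of `(t, x, u)`. -/
theorem dt_dx_dx_comp_graphPoint {A : TXU → ℝ} (hA : ContDiffAt ℝ ∞ A (graphPoint u p))
    (hu : ContDiffAt ℝ ∞ u p) :
    dt (dx (dx fun q => A (graphPoint u q))) p =
      (pt (px (px A)) (graphPoint u p) + pu (px (px A)) (graphPoint u p) * dt u p)
        + 2 * ((pt (px (pu A)) (graphPoint u p) + pu (px (pu A)) (graphPoint u p) * dt u p) * dx u p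
          + px (pu A) (graphPoint u p) * dt (dx u) p)
        + (pt (pu (pu A)) (graphPoint u p) + pu (pu (pu A)) (graphPoint u p) * dt u p) * dx u p ^ 2
        + 2 * pu (pu A) (graphPoint u p) * dx u p * dt (dx u) p
        + (pt (pu A) (graphPoint u p) + pu (pu A) (graphPoint u p) * dt u p) * dx (dx u) p
        + pu A (graphPoint u p) * dt (dx (dx u)) p := by
  have hc : Tendsto (graphPoint u) (𝓝 p) (𝓝 (graphPoint u p)) :=
    (contDiffAt_graphPoint hu).continuousAt
  have hx := contDiffAt_px hA
  have hU := contDiffAt_pu hA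
  have hxx := contDiffAt_px hx
  have hxU := contDiffAt_px hU
  have hUU := contDiffAt_pu hU
  have hxu : ContDiffAt ℝ ∞ (dx u) p := contDiffAt_dirDeriv (0, 1) hu
  have hxxu : ContDiffAt ℝ ∞ (dx (dx u)) p := contDiffAt_dirDeriv (0, 1) hxu
  have gx := contDiffAt_comp_graphPoint hx hu
  have gU := contDiffAt_comp_graphPoint hU hu
  have gxx := contDiffAt_comp_graphPoint hxx hu
  have gxU := contDiffAt_comp_graphPoint hxU hu
  have gUU := contDiffAt_comp_graphPoint hUU hu
  have h1 := dirDeriv_congr (0, 1) (dx_comp_graphPoint_eventually hA hu)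
  have h2 := dirDeriv_add (0, 1) gx (gU.mul hxu)
  have h3 := dirDeriv_mul (0, 1) gU hxu
  have h4 := dx_comp_graphPoint_eventually hx hu
  have h5 := dx_comp_graphPoint_eventually hU hu
  have h6 : ∀ᶠ q in 𝓝 p, pu (px A) (graphPoint u q) = px (pu A) (graphPoint u q) :=
    hc.eventually (dirDeriv_comm_eventually (0, 0, 1) (0, 1, 0) hA)
  have sxx : dx (dx fun q => A (graphPoint u q)) =ᶠ[𝓝 p] fun q =>
      (px (px A) (graphPoint u q) + 2 * (px (pu A) (graphPoint u q) * dx u q))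
        + (pu (pu A) (graphPoint u q) * (dx u q * dx u q)
        + pu A (graphPoint u q) * dx (dx u) q) := by
    filter_upwards [h1, h2, h3, h4, h5, h6] with q e1 e2 e3 e4 e5 e6
    simp only [dx_eq_dirDeriv] at *
    rw [e1, e2, e3, e4, e5, e6]
    ring
  have e0 := (dirDeriv_congr (1, 0) sxx).self_of_nhds
  have e1 := (dirDeriv_add (1, 0) (gxx.add (contDiffAt_const.mul (gxU.mul hxu) :
    ContDiffAt ℝ ∞ (fun q => (2 : ℝ) * (px (pu A) (graphPoint u q) * dx u q)) p))
    ((gUU.mul (hxu.mul hxu)).add (gU.mul hxxu))).self_of_nhds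
  have e2 := (dirDeriv_add (1, 0) gxx (contDiffAt_const.mul (gxU.mul hxu) :
    ContDiffAt ℝ ∞ (fun q => (2 : ℝ) * (px (pu A) (graphPoint u q) * dx u q)) p)).self_of_nhds
  have e3 := (dirDeriv_add (1, 0) (gUU.mul (hxu.mul hxu)) (gU.mul hxxu)).self_of_nhds
  have e4 := (dirDeriv_mul (1, 0) (contDiffAt_const (c := (2 : ℝ))) (gxU.mul hxu)).self_of_nhds
  have e5 := (dirDeriv_mul (1, 0) gxU hxu).self_of_nhds
  have e6 := (dirDeriv_mul (1, 0) gUU (hxu.mul hxu)).self_of_nhds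
  have e7 := (dirDeriv_mul (1, 0) hxu hxu).self_of_nhds
  have e8 := (dirDeriv_mul (1, 0) gU hxxu).self_of_nhds
  have f1 := (dt_comp_graphPoint_eventually hxx hu).self_of_nhds
  have f2 := (dt_comp_graphPoint_eventually hxU hu).self_of_nhds
  have f3 := (dt_comp_graphPoint_eventually hUU hu).self_of_nhds
  have f4 := (dt_comp_graphPoint_eventually hU hu).self_of_nhds
  have c2 : dirDeriv ((1, 0) : ℝ × ℝ) (fun _ => (2 : ℝ)) p = 0 := by simp [dirDeriv]
  simp only [dt_eq_dirDeriv] at *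
  rw [e0, e1, e2, e3, e4, e5, e6, e7, e8, f1, f2, f3, f4, c2]
  ring

theorem comp_graphPoint_congr {A B : TXU → ℝ} (hu : ContDiffAt ℝ ∞ u p)
    (h : A =ᶠ[𝓝 (graphPoint u p)] B) :
    (fun q => A (graphPoint u q)) =ᶠ[𝓝 p] fun q => B (graphPoint u q) := by
  have hc : Tendsto (graphPoint u) (𝓝 p) (𝓝 (graphPoint u p)) :=
    (contDiffAt_graphPoint hu).continuousAt
  exact hc.eventually h

theorem dirDeriv_zero_of_eventually {E : Type*} [NormedAddCommGroup E] [NormedSpace ℝ E]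
    {A : E → ℝ} {z : E} (e : E) (h : A =ᶠ[𝓝 z] fun _ => 0) :
    dirDeriv e A =ᶠ[𝓝 z] fun _ => 0 := by
  refine (dirDeriv_congr e h).trans (Eventually.of_forall fun y => ?_)
  simp [dirDeriv]

/-- The jets of `u` and of its transform `v`, when `T` depends on `t` only and `X` on `x` only. -/
theorem transformed_jets {Φ : TXU → TXU} {v : ℝ × ℝ → ℝ}
    (hΦ : ContDiffAt ℝ ∞ Φ (graphPoint u p)) (h : TransformsAt Φ u v p)
    (hTx : px (fun y => (Φ y).1) =ᶠ[𝓝 (graphPoint u p)] fun _ => 0)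
    (hTu : pu (fun y => (Φ y).1) =ᶠ[𝓝 (graphPoint u p)] fun _ => 0)
    (hXt : pt (fun y => (Φ y).2.1) =ᶠ[𝓝 (graphPoint u p)] fun _ => 0)
    (hXu : pu (fun y => (Φ y).2.1) =ᶠ[𝓝 (graphPoint u p)] fun _ => 0) :
    v (newBase Φ u p) = (Φ (graphPoint u p)).2.2 ∧
    pt (fun y => (Φ y).1) (graphPoint u p) * dt v (newBase Φ u p) =
      dt (fun q => (Φ (graphPoint u q)).2.2) p ∧
    px (fun y => (Φ y).2.1) (graphPoint u p) * dx v (newBase Φ u p) =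
      dx (fun q => (Φ (graphPoint u q)).2.2) p ∧
    pt (fun y => (Φ y).1) (graphPoint u p) * px (fun y => (Φ y).2.1) (graphPoint u p) ^ 3
        * dt (dx (dx v)) (newBase Φ u p) =
      px (fun y => (Φ y).2.1) (graphPoint u p) *
          dt (dx (dx fun q => (Φ (graphPoint u q)).2.2)) p
        - px (px fun y => (Φ y).2.1) (graphPoint u p) *
          dt (dx fun q => (Φ (graphPoint u q)).2.2) p := by
  obtain ⟨hu, hv, -, hvU⟩ := h
  set T : TXU → ℝ := fun y => (Φ y).1 with hT_def
  set X : TXU → ℝ := fun y => (Φ y).2.1 with hX_def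
  set N := newBase Φ u with hN_def
  have hT : ContDiffAt ℝ ∞ T (graphPoint u p) := contDiffAt_fst_comp hΦ
  have hX : ContDiffAt ℝ ∞ X (graphPoint u p) := contDiffAt_snd_fst_comp hΦ
  have gT := contDiffAt_comp_graphPoint hT hu
  have gX := contDiffAt_comp_graphPoint hX hu
  have hN : ContDiffAt ℝ ∞ N p := contDiffAt_newBase hΦ hu
  have hXx := contDiffAt_px hX
  have hXxx := contDiffAt_px hXx
  have gXx := contDiffAt_comp_graphPoint hXx hu
  have gXxx := contDiffAt_comp_graphPoint hXxx hu
  have dtT : dt (fun q => T (graphPoint u q)) =ᶠ[𝓝 p] fun q => pt T (graphPoint u q) := by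
    filter_upwards [dt_comp_graphPoint_eventually hT hu, comp_graphPoint_congr hu hTu] with q h1 h2
    rw [h1, h2]; ring
  have dxT : dx (fun q => T (graphPoint u q)) =ᶠ[𝓝 p] fun _ => 0 := by
    filter_upwards [dx_comp_graphPoint_eventually hT hu, comp_graphPoint_congr hu hTu,
      comp_graphPoint_congr hu hTx] with q h1 h2 h3
    rw [h1, h2, h3]; ring
  have dtX : dt (fun q => X (graphPoint u q)) =ᶠ[𝓝 p] fun _ => 0 := by
    filter_upwards [dt_comp_graphPoint_eventually hX hu, comp_graphPoint_congr hu hXu,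
      comp_graphPoint_congr hu hXt] with q h1 h2 h3
    rw [h1, h2, h3]; ring
  have dxX : dx (fun q => X (graphPoint u q)) =ᶠ[𝓝 p] fun q => px X (graphPoint u q) := by
    filter_upwards [dx_comp_graphPoint_eventually hX hu, comp_graphPoint_congr hu hXu] with q h1 h2
    rw [h1, h2]; ring
  have chain : ∀ {w : ℝ × ℝ → ℝ}, ContDiffAt ℝ ∞ w (N p) →
      (dt (fun q => w (N q)) =ᶠ[𝓝 p] fun q => dt w (N q) * pt T (graphPoint u q)) ∧
      (dx (fun q => w (N q)) =ᶠ[𝓝 p] fun q => dx w (N q) * px X (graphPoint u q)) := by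
    intro w hw
    have hNc : Tendsto N (𝓝 p) (𝓝 (N p)) := hN.continuousAt
    constructor
    · filter_upwards [hNc.eventually (eventually_differentiableAt hw),
        eventually_differentiableAt gT, eventually_differentiableAt gX, dtT, dtX]
        with q h1 h2 h3 h4 h5
      have := dirDeriv_comp_pair (1, 0) h1 h2 h3
      rw [dt_eq_dirDeriv] at h4 h5
      rw [h4, h5, mul_zero, add_zero] at this
      exact this
    · filter_upwards [hNc.eventually (eventually_differentiableAt hw),
        eventually_differentiableAt gT, eventually_differentiableAt gX, dxT, dxX]
        with q h1 h2 h3 h4 h5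
      have := dirDeriv_comp_pair (0, 1) h1 h2 h3
      rw [dx_eq_dirDeriv] at h4 h5
      rw [h4, h5, mul_zero, zero_add] at this
      exact this
  have hXxt : pt (px X) =ᶠ[𝓝 (graphPoint u p)] fun _ => 0 :=
    (dirDeriv_comm_eventually _ _ hX).trans (dirDeriv_zero_of_eventually _ hXt)
  have hXxu : pu (px X) =ᶠ[𝓝 (graphPoint u p)] fun _ => 0 :=
    (dirDeriv_comm_eventually _ _ hX).trans (dirDeriv_zero_of_eventually _ hXu)
  have hXxxt : pt (px (px X)) =ᶠ[𝓝 (graphPoint u p)] fun _ => 0 :=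
    (dirDeriv_comm_eventually _ _ hXx).trans (dirDeriv_zero_of_eventually _ hXxt)
  have hXxxu : pu (px (px X)) =ᶠ[𝓝 (graphPoint u p)] fun _ => 0 :=
    (dirDeriv_comm_eventually _ _ hXx).trans (dirDeriv_zero_of_eventually _ hXxu)
  have dxXx : dx (fun q => px X (graphPoint u q)) =ᶠ[𝓝 p]
      fun q => px (px X) (graphPoint u q) := by
    filter_upwards [dx_comp_graphPoint_eventually hXx hu, comp_graphPoint_congr hu hXxu]
      with q h1 h2
    rw [h1, h2]; ring
  have dtXx : dt (fun q => px X (graphPoint u q)) p = 0 := by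
    rw [(dt_comp_graphPoint_eventually hXx hu).self_of_nhds]
    simp only [hXxt.self_of_nhds, hXxu.self_of_nhds, zero_mul, add_zero]
  have dtXxx : dt (fun q => px (px X) (graphPoint u q)) p = 0 := by
    rw [(dt_comp_graphPoint_eventually hXxx hu).self_of_nhds]
    simp only [hXxxt.self_of_nhds, hXxxu.self_of_nhds, zero_mul, add_zero]
  have hW : (fun q => (Φ (graphPoint u q)).2.2) =ᶠ[𝓝 p] fun q => v (N q) := by
    filter_upwards [hvU] with q hq
    exact hq.symm
  have hvx : ContDiffAt ℝ ∞ (dx v) (N p) := contDiffAt_dirDeriv (0, 1) hv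
  have hvxx : ContDiffAt ℝ ∞ (dx (dx v)) (N p) := contDiffAt_dirDeriv (0, 1) hvx
  have gvx : ContDiffAt ℝ ∞ (fun q => dx v (N q)) p := hvx.comp p hN
  have gvxx : ContDiffAt ℝ ∞ (fun q => dx (dx v) (N q)) p := hvxx.comp p hN
  have wt := (dirDeriv_congr (1, 0) hW).trans (chain hv).1
  have wx := (dirDeriv_congr (0, 1) hW).trans (chain hv).2
  have wxx : dx (dx fun q => (Φ (graphPoint u q)).2.2) =ᶠ[𝓝 p] fun q =>
      dx (dx v) (N q) * (px X (graphPoint u q) * px X (graphPoint u q))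
        + dx v (N q) * px (px X) (graphPoint u q) := by
    filter_upwards [dirDeriv_congr (0, 1) wx, dirDeriv_mul (0, 1) gvx gXx, dxXx, (chain hvx).2]
      with q h1 h2 h3 h4
    simp only [dx_eq_dirDeriv] at *
    rw [h1, h2, h3, h4]
    ring
  have wtx : dt (dx fun q => (Φ (graphPoint u q)).2.2) p =
      dt (dx v) (N p) * pt T (graphPoint u p) * px X (graphPoint u p) := by
    have h1 := (dirDeriv_congr (1, 0) wx).self_of_nhds
    have h2 := (dirDeriv_mul (1, 0) gvx gXx).self_of_nhds
    have h3 := (chain hvx).1.self_of_nhds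
    simp only [dt_eq_dirDeriv, dx_eq_dirDeriv] at *
    rw [h1, h2, h3, dtXx]
    ring
  have wtxx : dt (dx (dx fun q => (Φ (graphPoint u q)).2.2)) p =
      dt (dx (dx v)) (N p) * pt T (graphPoint u p) * px X (graphPoint u p) ^ 2
        + dt (dx v) (N p) * pt T (graphPoint u p) * px (px X) (graphPoint u p) := by
    have h1 := (dirDeriv_congr (1, 0) wxx).self_of_nhds
    have h2 := (dirDeriv_add (1, 0) (gvxx.mul (gXx.mul gXx)) (gvx.mul gXxx)).self_of_nhds
    have h3 := (dirDeriv_mul (1, 0) gvxx (gXx.mul gXx)).self_of_nhds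
    have h4 := (dirDeriv_mul (1, 0) gXx gXx).self_of_nhds
    have h5 := (dirDeriv_mul (1, 0) gvx gXxx).self_of_nhds
    have h6 := (chain hvxx).1.self_of_nhds
    have h7 := (chain hvx).1.self_of_nhds
    simp only [dt_eq_dirDeriv, dx_eq_dirDeriv] at *
    rw [h1, h2, h3, h4, h5, h6, h7, dtXx, dtXxx]
    ring
  refine ⟨hvU.self_of_nhds, ?_, ?_, ?_⟩
  · rw [mul_comm]; exact wt.self_of_nhds.symm
  · rw [mul_comm]; exact wx.self_of_nhds.symm
  -- Both total derivatives contain v_tx; this combination cancels it and leaves v_txx alone.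
  · rw [wtx, wtxx]; ring

end Jets

/-! ### The determining equations and their consequences. -/

/-- The diagonal entries of the derivative of `Φ` do not vanish. -/
theorem partials_ne_zero {Φ : TXU → TXU} {z : TXU} (hs : ContDiffAt ℝ ∞ Φ z)
    (hdet : (fderiv ℝ Φ z).det ≠ 0)
    (hTx : px (fun y => (Φ y).1) z = 0) (hTu : pu (fun y => (Φ y).1) z = 0)
    (hXt : pt (fun y => (Φ y).2.1) z = 0) (hXu : pu (fun y => (Φ y).2.1) z = 0) :
    pt (fun y => (Φ y).1) z ≠ 0 ∧ px (fun y => (Φ y).2.1) z ≠ 0 ∧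
      pu (fun y => (Φ y).2.2) z ≠ 0 := by
  obtain ⟨Ψ, hΨ⟩ := exists_equiv_of_det_ne_zero _ hdet
  have hd := fderiv_eq_triple (differentiableAt_of_smooth hs)
  have hsurj : ∀ w, ∃ a b c, fderiv ℝ Φ z (a, b, c) = w := fun w =>
    ⟨(Ψ.symm w).1, (Ψ.symm w).2.1, (Ψ.symm w).2.2, by rw [← hΨ]; simp⟩
  refine ⟨fun h0 => ?_, fun h0 => ?_, fun h0 => ?_⟩
  · obtain ⟨a, b, c, h1⟩ := hsurj (1, 0, 0)
    have := congrArg Prod.fst ((hd _).symm.trans h1)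
    simp only [fderiv_eq_partials, h0, hTx, hTu] at this
    norm_num at this
  · obtain ⟨a, b, c, h1⟩ := hsurj (0, 1, 0)
    have := congrArg (fun w : TXU => w.2.1) ((hd _).symm.trans h1)
    simp only [fderiv_eq_partials, h0, hXt, hXu] at this
    norm_num at this
  · have h1 : fderiv ℝ Φ z (0, 0, 1) = 0 := by
      rw [hd]
      simp only [fderiv_eq_partials, hTu, hXu, h0]
      ext <;> simp
    rw [← hΨ] at h1
    have h2 : ((0, 0, 1) : TXU) = 0 := by
      have := congrArg Ψ.symm h1
      simp at this
    simp at h2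

/-- The determining equation in the jet variables `a = u_t`, `b = u_x`, `c = u_xx`, `d = u_tx`. -/
theorem MapsEquation.determining {Ω : Set TXU} {Φ : TXU → TXU} {θ θ' : Equation}
    (hΦ : IsPointTransformation Ω Φ) (hΩ : IsOpen Ω) (h : MapsEquation Ω Φ θ θ')
    {T X U : TXU → ℝ} (hT : T = fun y => (Φ y).1) (hX : X = fun y => (Φ y).2.1)
    (hU : U = fun y => (Φ y).2.2) {z : TXU} (hz : z ∈ Ω) (a b c d : ℝ) :
    px X z ^ 3 * (pt U z + pu U z * a)
      + pt T z * px X z ^ 2 * (θ'.f (T z) + θ'.g (T z) * U z) * (px U z + pu U z * b)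
      + θ'.h (T z) * (px X z *
          ((pt (px (px U)) z + pu (px (px U)) z * a)
            + 2 * ((pt (px (pu U)) z + pu (px (pu U)) z * a) * b + px (pu U) z * d)
            + (pt (pu (pu U)) z + pu (pu (pu U)) z * a) * b ^ 2
            + 2 * pu (pu U) z * b * d
            + (pt (pu U) z + pu (pu U) z * a) * c
            + pu U z * (-(a + θ.f z.1 * b + θ.g z.1 * z.2.2 * b) / θ.h z.1))
        - px (px X) z * (pt (px U) z + pu (px U) z * a
            + (pt (pu U) z + pu (pu U) z * a) * b + pu U z * d)) = 0 := by
  have hb := fun {y} (hy : y ∈ Ω) => h.base_partials hΦ hΩ hy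
  obtain ⟨t, x, r⟩ := z
  have hs : ContDiffAt ℝ ∞ Φ (t, x, r) := hΦ.1.contDiffAt (hΩ.mem_nhds hz)
  obtain ⟨b1, b2, b3, b4⟩ := hb hz
  obtain ⟨n1, n2, n3⟩ := partials_ne_zero hs (hΦ.2 _ hz) b1 b2 b3 b4
  have hθh : θ.h t ≠ 0 := fun h0 => θ.gh_ne_zero t (h.1 _ hz).1 (by rw [h0, mul_zero])
  -- The value of u_txx imposed by `θ`; the other jets `a`, `b`, `c`, `d` stay free.
  set e := -(a + θ.f t * b + θ.g t * r * b) / θ.h t with he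
  set u := jetPoly (t, x) r a b c d e with hu_def
  have hu : ContDiffAt ℝ ∞ u (t, x) := (contDiff_jetPoly _ _ _ _ _ _ _).contDiffAt
  have hg : graphPoint u (t, x) = (t, x, r) := graphPoint_jetPoly _ _ _ _ _ _ _ _
  have jt : dt u (t, x) = a := dt_jetPoly _ _ _ _ _ _ _
  have jx : dx u (t, x) = b := by simp [hu_def, dx_jetPoly, jetPoly_self]
  have jxx : dx (dx u) (t, x) = c := by simp [hu_def, dx_jetPoly, jetPoly_self]
  have jtx : dt (dx u) (t, x) = d := by simp [hu_def, dx_jetPoly, dt_jetPoly]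
  have jtxx : dt (dx (dx u)) (t, x) = e := by simp [hu_def, dx_jetPoly, dt_jetPoly]
  have hs' : ContDiffAt ℝ ∞ Φ (graphPoint u (t, x)) := by rwa [hg]
  have hdet : (fderiv ℝ (newBase Φ u) (t, x)).det ≠ 0 := by
    rw [det_prod_eq, fderiv_newBase_dt hs' hu, fderiv_newBase_dx hs' hu, hg, b1, b2, b3, b4]
    simp [n1, n2]
  obtain ⟨v, hv⟩ := exists_transformsAt hs' hu hdet
  have hθ : θ.HoldsAt u (t, x) :=
    (holdsAt_jetPoly _ _ _ _ _ _ _ _ _).2 (by rw [he]; field_simp; ring)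
  have hθ' := (h.2 u v (t, x) (by rwa [hg]) hv).1 hθ
  have ev : ∀ᶠ y in 𝓝 (graphPoint u (t, x)), y ∈ Ω := hΩ.mem_nhds (by rwa [hg])
  obtain ⟨q0, q1, q2, q3⟩ := transformed_jets hs' hv
    (by filter_upwards [ev] with y hy using (hb hy).1)
    (by filter_upwards [ev] with y hy using (hb hy).2.1)
    (by filter_upwards [ev] with y hy using (hb hy).2.2.1)
    (by filter_upwards [ev] with y hy using (hb hy).2.2.2)
  have hUs : ContDiffAt ℝ ∞ U (graphPoint u (t, x)) := hU ▸ contDiffAt_snd_snd_comp hs'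
  have w1 := dt_comp_graphPoint (differentiableAt_of_smooth hUs) (differentiableAt_of_smooth hu)
  have w2 := dx_comp_graphPoint (differentiableAt_of_smooth hUs) (differentiableAt_of_smooth hu)
  have w3 := dt_dx_comp_graphPoint hUs hu
  have w4 := dt_dx_dx_comp_graphPoint hUs hu
  have hUg : (fun q => (Φ (graphPoint u q)).2.2) = fun q => U (graphPoint u q) := by rw [hU]
  have hUz : (Φ (graphPoint u (t, x))).2.2 = U (graphPoint u (t, x)) := by rw [hU]
  have hTz : (newBase Φ u (t, x)).1 = T (t, x, r) := by simp [newBase, hg, hT]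
  rw [hUg, ← hT] at q1
  rw [hUg, ← hX] at q2
  rw [hUg, ← hT, ← hX] at q3
  rw [hUz] at q0
  rw [w1] at q1
  rw [w2] at q2
  rw [w3, w4] at q3
  rw [hg] at q0 q1 q2 q3
  rw [jt] at q1
  rw [jx] at q2
  rw [jt, jx, jxx, jtx, jtxx] at q3
  unfold Equation.HoldsAt at hθ'
  rw [hTz, q0] at hθ'
  -- The target equation is multiplied by T_t X_x³ to clear the denominators of the transformed
  -- jets.
  linear_combination (pt T (t, x, r) * px X (t, x, r) ^ 3) * hθ' - px X (t, x, r) ^ 3 * q1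
    - pt T (t, x, r) * px X (t, x, r) ^ 2 * (θ'.f (T (t, x, r)) + θ'.g (T (t, x, r)) *
      U (t, x, r)) * q2 - θ'.h (T (t, x, r)) * q3

theorem eventually_zero_of_forall {Ω : Set TXU} (hΩ : IsOpen Ω) {A : TXU → ℝ}
    (h : ∀ z ∈ Ω, A z = 0) {z : TXU} (hz : z ∈ Ω) : A =ᶠ[𝓝 z] fun _ => 0 := by
  filter_upwards [hΩ.mem_nhds hz] with y hy using h y hy

theorem dirDeriv_zero_of_forall {Ω : Set TXU} (hΩ : IsOpen Ω) {A : TXU → ℝ}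
    (h : ∀ z ∈ Ω, A z = 0) (e : TXU) : ∀ z ∈ Ω, dirDeriv e A z = 0 := fun _ hz =>
  (dirDeriv_zero_of_eventually e (eventually_zero_of_forall hΩ h hz)).self_of_nhds

theorem Equation.h_ne_zero (θ : Equation) {t : ℝ} (ht : t ∈ θ.I) : θ.h t ≠ 0 :=
  fun h0 => θ.gh_ne_zero t ht (by rw [h0, mul_zero])

theorem Equation.g_ne_zero (θ : Equation) {t : ℝ} (ht : t ∈ θ.I) : θ.g t ≠ 0 :=
  fun h0 => θ.gh_ne_zero t ht (by rw [h0, zero_mul])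

/-- The consequences of the determining equations at every point of the domain. -/
structure DeterminedAt (Φ : TXU → TXU) (θ θ' : Equation) (z : TXU) : Prop where
  Tx : px (fun y => (Φ y).1) z = 0
  Tu : pu (fun y => (Φ y).1) z = 0
  Xt : pt (fun y => (Φ y).2.1) z = 0
  Xu : pu (fun y => (Φ y).2.1) z = 0
  Ut : pt (fun y => (Φ y).2.2) z = 0
  Ux : px (fun y => (Φ y).2.2) z = 0
  Xxx : px (px fun y => (Φ y).2.1) z = 0
  Uuu : pu (pu fun y => (Φ y).2.2) z = 0
  Tt_ne : pt (fun y => (Φ y).1) z ≠ 0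
  Xx_ne : px (fun y => (Φ y).2.1) z ≠ 0
  Uu_ne : pu (fun y => (Φ y).2.2) z ≠ 0
  h_eq : θ'.h (Φ z).1 = θ.h z.1 * px (fun y => (Φ y).2.1) z ^ 2
  g_eq : pt (fun y => (Φ y).1) z * θ'.g (Φ z).1 * pu (fun y => (Φ y).2.2) z =
    px (fun y => (Φ y).2.1) z * θ.g z.1
  f_eq : pt (fun y => (Φ y).1) z * (θ'.f (Φ z).1 + θ'.g (Φ z).1 * (Φ z).2.2) =
    px (fun y => (Φ y).2.1) z * (θ.f z.1 + θ.g z.1 * z.2.2)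

/-- Coefficients of the determining polynomial are isolated by differencing its values at jets with
entries 0 and 1: the bd term gives U_uu, c gives U_tu, d links X_xx to U_xu, b gives `hRel`, a gives
the new `h`, and the constant term gives U_t. The remaining facts come from differentiating `hRel`.
-/
theorem MapsEquation.determinedAt {Ω : Set TXU} {Φ : TXU → TXU} {θ θ' : Equation}
    (hΦ : IsPointTransformation Ω Φ) (hΩ : IsOpen Ω) (h : MapsEquation Ω Φ θ θ')
    {z : TXU} (hz : z ∈ Ω) : DeterminedAt Φ θ θ' z := by
  have hs : ∀ z ∈ Ω, ContDiffAt ℝ ∞ Φ z := fun z hz => hΦ.1.contDiffAt (hΩ.mem_nhds hz)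
  obtain ⟨T, hT⟩ : ∃ T : TXU → ℝ, T = fun y => (Φ y).1 := ⟨_, rfl⟩
  obtain ⟨X, hX⟩ : ∃ X : TXU → ℝ, X = fun y => (Φ y).2.1 := ⟨_, rfl⟩
  obtain ⟨U, hU⟩ : ∃ U : TXU → ℝ, U = fun y => (Φ y).2.2 := ⟨_, rfl⟩
  have sT : ∀ z ∈ Ω, ContDiffAt ℝ ∞ T z := fun z hz => hT ▸ contDiffAt_fst_comp (hs z hz)
  have sX : ∀ z ∈ Ω, ContDiffAt ℝ ∞ X z := fun z hz => hX ▸ contDiffAt_snd_fst_comp (hs z hz)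
  have sU : ∀ z ∈ Ω, ContDiffAt ℝ ∞ U z := fun z hz => hU ▸ contDiffAt_snd_snd_comp (hs z hz)
  have hTx : ∀ z ∈ Ω, px T z = 0 := fun z hz => hT ▸ (h.base_partials hΦ hΩ hz).1
  have hTu : ∀ z ∈ Ω, pu T z = 0 := fun z hz => hT ▸ (h.base_partials hΦ hΩ hz).2.1
  have hXt : ∀ z ∈ Ω, pt X z = 0 := fun z hz => hX ▸ (h.base_partials hΦ hΩ hz).2.2.1
  have hXu : ∀ z ∈ Ω, pu X z = 0 := fun z hz => hX ▸ (h.base_partials hΦ hΩ hz).2.2.2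
  have hne : ∀ z ∈ Ω, pt T z ≠ 0 ∧ px X z ≠ 0 ∧ pu U z ≠ 0 := by
    intro z hz
    obtain ⟨b1, b2, b3, b4⟩ := h.base_partials hΦ hΩ hz
    rw [hT, hX, hU]
    exact partials_ne_zero (hs z hz) (hΦ.2 _ hz) b1 b2 b3 b4
  have hI : ∀ z ∈ Ω, z.1 ∈ θ.I ∧ T z ∈ θ'.I := fun z hz => hT ▸ h.1 z hz
  have hH : ∀ z ∈ Ω, θ'.h (T z) ≠ 0 := fun z hz => θ'.h_ne_zero (hI z hz).2
  have hh : ∀ z ∈ Ω, θ.h z.1 ≠ 0 := fun z hz => θ.h_ne_zero (hI z hz).1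
  have det := fun z (hz : z ∈ Ω) => h.determining hΦ hΩ hT hX hU hz
  have hUuu : ∀ z ∈ Ω, pu (pu U) z = 0 := by
    intro z hz
    have h1 := det z hz 0 1 0 1
    have h2 := det z hz 0 1 0 0
    have h3 := det z hz 0 0 0 1
    have h4 := det z hz 0 0 0 0
    have : (θ'.h (T z) * px X z) * pu (pu U) z = 0 := by
      linear_combination (h1 - h2 - h3 + h4) / 2
    exact (mul_eq_zero.1 this).resolve_left (mul_ne_zero (hH z hz) (hne z hz).2.1)
  have hUut : ∀ z ∈ Ω, pt (pu U) z = 0 := by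
    intro z hz
    have h3 := det z hz 0 0 1 0
    have h4 := det z hz 0 0 0 0
    have : (θ'.h (T z) * px X z) * pt (pu U) z = 0 := by linear_combination h3 - h4
    exact (mul_eq_zero.1 this).resolve_left (mul_ne_zero (hH z hz) (hne z hz).2.1)
  have hXU : ∀ z ∈ Ω, 2 * px X z * px (pu U) z = px (px X) z * pu U z := by
    intro z hz
    have h3 := det z hz 0 0 0 1
    have h4 := det z hz 0 0 0 0
    have : θ'.h (T z) * (2 * px X z * px (pu U) z - px (px X) z * pu U z) = 0 := by
      linear_combination h3 - h4
    linarith [(mul_eq_zero.1 this).resolve_left (hH z hz)]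
  have hUutx : ∀ z ∈ Ω, pt (px (pu U)) z = 0 := by
    intro z hz
    rw [pt, px, dirDeriv_comm _ _ (contDiffAt_pu (sU z hz))]
    exact dirDeriv_zero_of_forall hΩ hUut _ z hz
  have hUuut : ∀ z ∈ Ω, pt (pu (pu U)) z = 0 := dirDeriv_zero_of_forall hΩ hUuu _
  have hRel : ∀ z ∈ Ω, pt T z * px X z * (θ'.f (T z) + θ'.g (T z) * U z) * θ.h z.1 =
      θ'.h (T z) * (θ.f z.1 + θ.g z.1 * z.2.2) := by
    intro z hz
    have h3 := det z hz 0 1 0 0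
    have h4 := det z hz 0 0 0 0
    rw [hUut z hz, hUuu z hz, hUutx z hz, hUuut z hz] at h3
    rw [hUut z hz, hUuu z hz, hUutx z hz, hUuut z hz] at h4
    have h0 := hh z hz
    have h5 : (px X z * pu U z) * (pt T z * px X z * (θ'.f (T z) + θ'.g (T z) * U z) -
        θ'.h (T z) * ((θ.f z.1 + θ.g z.1 * z.2.2) / θ.h z.1)) = 0 := by
      linear_combination h3 - h4
    have h6 := (mul_eq_zero.1 h5).resolve_left (mul_ne_zero (hne z hz).2.1 (hne z hz).2.2)
    field_simp at h6
    linarith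
  have line : ∀ {A : TXU → ℝ} {z : TXU} (e : TXU), ContDiffAt ℝ ∞ A z →
      HasDerivAt (fun s : ℝ => A (z + s • e)) (dirDeriv e A z) 0 := by
    intro A z e hA
    have := hasDerivAt_line (A := A) (z := z) e 0 (by simpa using differentiableAt_of_smooth hA)
    simpa using this
  -- The coefficients of `θ'` enter through T, so they are stationary in the directions x and u,
  -- where T is.
  have lineT : ∀ {F : ℝ → ℝ} {z : TXU} (e : TXU), z ∈ Ω → ContDiffOn ℝ ∞ F θ'.I →
      dirDeriv e T z = 0 → HasDerivAt (fun s : ℝ => F (T (z + s • e))) 0 0 := by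
    intro F z e hz hF he
    have h1 : HasDerivAt F (deriv F (T (z + (0 : ℝ) • e))) (T (z + (0 : ℝ) • e)) := by
      have := (hF.contDiffAt (θ'.isOpen_I.mem_nhds (hI z hz).2)).differentiableAt (by simp)
      simpa using this.hasDerivAt
    have h2 := HasDerivAt.comp (0 : ℝ) (h₂ := F) (h := fun s : ℝ => T (z + s • e)) h1
      (line e (sT z hz))
    rwa [he, mul_zero] at h2
  have evl : ∀ {z : TXU} (e : TXU), z ∈ Ω → ∀ᶠ s : ℝ in 𝓝 0, z + s • e ∈ Ω := by
    intro z e hz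
    have : Continuous fun s : ℝ => z + s • e := by fun_prop
    have := this.tendsto 0
    simp only [zero_smul, add_zero] at this
    exact this (hΩ.mem_nhds hz)
  have hTtx : ∀ z ∈ Ω, px (pt T) z = 0 := by
    intro z hz
    rw [pt, px, dirDeriv_comm _ _ (sT z hz)]
    exact dirDeriv_zero_of_forall hΩ hTx _ z hz
  have hTtu : ∀ z ∈ Ω, pu (pt T) z = 0 := by
    intro z hz
    rw [pt, pu, dirDeriv_comm _ _ (sT z hz)]
    exact dirDeriv_zero_of_forall hΩ hTu _ z hz
  have hXxu : ∀ z ∈ Ω, pu (px X) z = 0 := by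
    intro z hz
    rw [px, pu, dirDeriv_comm _ _ (sX z hz)]
    exact dirDeriv_zero_of_forall hΩ hXu _ z hz
  -- The u-derivative of `hRel`: there `U` and the explicit u are the only quantities varying with
  -- u.
  have hRelu : ∀ z ∈ Ω, pt T z * px X z * (θ'.g (T z) * pu U z) * θ.h z.1 =
      θ'.h (T z) * θ.g z.1 := by
    intro z hz
    have l1 := ((((line (0, 0, 1) (contDiffAt_pt (sT z hz))).fun_mul
      (line (0, 0, 1) (contDiffAt_px (sX z hz)))).fun_mul
      ((lineT (0, 0, 1) hz θ'.smooth_f (hTu z hz)).fun_add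
        ((lineT (0, 0, 1) hz θ'.smooth_g (hTu z hz)).fun_mul (line (0, 0, 1) (sU z hz))))).mul_const
      (θ.h z.1))
    have l2 := (lineT (0, 0, 1) hz θ'.smooth_h (hTu z hz)).fun_mul
      (((hasDerivAt_id (0 : ℝ)).const_add z.2.2).const_mul (θ.g z.1) |>.const_add (θ.f z.1))
    have l3 := l1.unique (l2.congr_of_eventuallyEq (by
      filter_upwards [evl (0, 0, 1) hz] with s hs
      have := hRel _ hs
      simpa using this))
    have e1 : dirDeriv (0, 0, 1) (pt T) z = 0 := hTtu z hz
    have e2 : dirDeriv (0, 0, 1) (px X) z = 0 := hXxu z hz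
    rw [e1, e2] at l3
    simp only [zero_smul, add_zero, zero_mul, mul_zero, zero_add, mul_one] at l3
    linear_combination l3
  -- The x-derivative of `hRelu`: X_x U_u does not vary with x. Added to `hXU` this gives 3 X_x U_xu
  -- = 0, so both second derivatives vanish.
  have hXU' : ∀ z ∈ Ω, px (px X) z * pu U z + px X z * px (pu U) z = 0 := by
    intro z hz
    have l1 := (((line (0, 1, 0) (contDiffAt_pt (sT z hz))).fun_mul
      (line (0, 1, 0) (contDiffAt_px (sX z hz)))).fun_mul
      ((lineT (0, 1, 0) hz θ'.smooth_g (hTx z hz)).fun_mul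
        (line (0, 1, 0) (contDiffAt_pu (sU z hz))))).mul_const (θ.h z.1)
    have l2 := (lineT (0, 1, 0) hz θ'.smooth_h (hTx z hz)).mul_const (θ.g z.1)
    have l3 := l1.unique (l2.congr_of_eventuallyEq (by
      filter_upwards [evl (0, 1, 0) hz] with s hs
      have := hRelu _ hs
      simpa using this))
    have e1 : dirDeriv (0, 1, 0) (pt T) z = 0 := hTtx z hz
    rw [e1] at l3
    simp only [zero_smul, add_zero, zero_mul, zero_add] at l3
    have h1 : (pt T z * θ'.g (T z) * θ.h z.1) *
        (px (px X) z * pu U z + px X z * px (pu U) z) = 0 := by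
      linear_combination l3
    exact (mul_eq_zero.1 h1).resolve_left (mul_ne_zero (mul_ne_zero (hne z hz).1
      (θ'.g_ne_zero (hI z hz).2)) (hh z hz))
  have hUxu : ∀ z ∈ Ω, px (pu U) z = 0 := by
    intro z hz
    have : px X z * px (pu U) z = 0 := by linear_combination (hXU' z hz + hXU z hz) / 3
    exact (mul_eq_zero.1 this).resolve_left (hne z hz).2.1
  have hXxx : ∀ z ∈ Ω, px (px X) z = 0 := by
    intro z hz
    have := hXU' z hz
    rw [hUxu z hz, mul_zero, add_zero] at this
    exact (mul_eq_zero.1 this).resolve_right (hne z hz).2.2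
  have hUx : ∀ z ∈ Ω, px U z = 0 := by
    intro z hz
    have l1 := ((((line (0, 1, 0) (contDiffAt_pt (sT z hz))).fun_mul
      (line (0, 1, 0) (contDiffAt_px (sX z hz)))).fun_mul
      ((lineT (0, 1, 0) hz θ'.smooth_f (hTx z hz)).fun_add
        ((lineT (0, 1, 0) hz θ'.smooth_g (hTx z hz)).fun_mul (line (0, 1, 0) (sU z hz))))).mul_const
      (θ.h z.1))
    have l2 := (lineT (0, 1, 0) hz θ'.smooth_h (hTx z hz)).mul_const
      (θ.f z.1 + θ.g z.1 * z.2.2)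
    have l3 := l1.unique (l2.congr_of_eventuallyEq (by
      filter_upwards [evl (0, 1, 0) hz] with s hs
      have := hRel _ hs
      simpa using this))
    have e1 : dirDeriv (0, 1, 0) (pt T) z = 0 := hTtx z hz
    have e2 : dirDeriv (0, 1, 0) (px X) z = 0 := hXxx z hz
    rw [e1, e2] at l3
    simp only [zero_smul, add_zero, zero_mul, zero_add, mul_zero] at l3
    have h1 : (pt T z * px X z * θ'.g (T z) * θ.h z.1) * px U z = 0 := by
      linear_combination l3
    exact (mul_eq_zero.1 h1).resolve_left (mul_ne_zero (mul_ne_zero (mul_ne_zero (hne z hz).1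
      (hne z hz).2.1) (θ'.g_ne_zero (hI z hz).2)) (hh z hz))
  have hUxx : ∀ z ∈ Ω, px (px U) z = 0 := dirDeriv_zero_of_forall hΩ hUx _
  have hUxxt : pt (px (px U)) z = 0 := dirDeriv_zero_of_forall hΩ hUxx _ z hz
  have hUxxu : pu (px (px U)) z = 0 := dirDeriv_zero_of_forall hΩ hUxx _ z hz
  have hUt : pt U z = 0 := by
    have h4 := det z hz 0 0 0 0
    rw [hUx z hz, hXxx z hz, hUxxt] at h4
    have : px X z ^ 3 * pt U z = 0 := by linear_combination h4
    exact (mul_eq_zero.1 this).resolve_left (pow_ne_zero _ (hne z hz).2.1)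
  have hHh : θ'.h (T z) = θ.h z.1 * px X z ^ 2 := by
    have h3 := det z hz 1 0 0 0
    have h4 := det z hz 0 0 0 0
    rw [hXxx z hz, hUxxu] at h3
    rw [hXxx z hz] at h4
    have h0 := hh z hz
    have h5 : (px X z * pu U z) * (px X z ^ 2 - θ'.h (T z) / θ.h z.1) = 0 := by
      linear_combination h3 - h4
    have h6 := (mul_eq_zero.1 h5).resolve_left (mul_ne_zero (hne z hz).2.1 (hne z hz).2.2)
    field_simp at h6
    linarith
  have hG : pt T z * θ'.g (T z) * pu U z = px X z * θ.g z.1 := by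
    have h1 := hRelu z hz
    rw [hHh] at h1
    refine mul_left_cancel₀ (mul_ne_zero (hne z hz).2.1 (hh z hz)) ?_
    linear_combination h1
  have hF : pt T z * (θ'.f (T z) + θ'.g (T z) * U z) =
      px X z * (θ.f z.1 + θ.g z.1 * z.2.2) := by
    have h1 := hRel z hz
    rw [hHh] at h1
    refine mul_left_cancel₀ (mul_ne_zero (hne z hz).2.1 (hh z hz)) ?_
    linear_combination h1
  have n := hne z hz
  have a1 := hTx z hz
  have a2 := hTu z hz
  have a3 := hXt z hz
  have a4 := hXu z hz
  have a5 := hUx z hz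
  have a6 := hXxx z hz
  have a7 := hUuu z hz
  subst hT hX hU
  exact ⟨a1, a2, a3, a4, hUt, a5, a6, a7, n.1, n.2.1, n.2.2, hHh, hG, hF⟩

/-! ### Primitives and inverses in one variable. -/

section OneVariable

/-- A primitive of a continuous function on an open interval. -/
theorem exists_primitive {I : Set ℝ} (hI : IsOpen I) (hc : IsConnected I) {g : ℝ → ℝ}
    (hg : ContinuousOn g I) : ∃ G : ℝ → ℝ, ∀ t ∈ I, HasDerivAt G (g t) t := by
  obtain ⟨a, ha⟩ := hc.nonempty
  have ho : OrdConnected I := hc.isPreconnected.ordConnected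
  refine ⟨fun t => ∫ s in a..t, g s, fun t ht => ?_⟩
  refine intervalIntegral.integral_hasDerivAt_right ?_ ?_ (hg.continuousAt (hI.mem_nhds ht))
  · exact (hg.mono (ho.uIcc_subset ha ht)).intervalIntegrable
  · exact hg.stronglyMeasurableAtFilter hI t ht

/-- A function with nonvanishing derivative on an interval is injective. -/
theorem injOn_of_hasDerivAt_ne_zero {I : Set ℝ} (ho : OrdConnected I) {G g : ℝ → ℝ}
    (hG : ∀ t ∈ I, HasDerivAt G (g t) t) (hg : ∀ t ∈ I, g t ≠ 0) : InjOn G I := by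
  have key : ∀ a ∈ I, ∀ b ∈ I, a < b → G a ≠ G b := by
    intro a ha b hb hab heq
    have hsub : Icc a b ⊆ I := ho.out ha hb
    obtain ⟨c, hc, hc0⟩ := exists_hasDerivAt_eq_zero hab
      (fun t ht => (hG t (hsub ht)).continuousAt.continuousWithinAt) heq
      (fun t ht => hG t (hsub (Ioo_subset_Icc_self ht)))
    exact hg c (hsub (Ioo_subset_Icc_self hc)) hc0
  intro a ha b hb heq
  rcases lt_trichotomy a b with h | h | h
  · exact absurd heq (key a ha b hb h)
  · exact h
  · exact absurd heq.symm (key b hb a ha h)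

theorem contDiffAt_deriv {T : ℝ → ℝ} {t : ℝ} (hT : ContDiffAt ℝ ∞ T t) :
    ContDiffAt ℝ ∞ (deriv T) t := by
  have h : ContDiffAt ℝ ∞ (fderiv ℝ T) t := hT.fderiv_right (by simp)
  exact h.clm_apply contDiffAt_const

/-- The smooth inverse of a function with nonvanishing derivative on an open interval. -/
theorem exists_smooth_inverse {K : Set ℝ} (hK : IsOpen K) (ho : OrdConnected K) {T : ℝ → ℝ}
    (hT : ContDiffOn ℝ ∞ T K) (hd : ∀ t ∈ K, deriv T t ≠ 0) :
    ∃ S : ℝ → ℝ, (∀ t ∈ K, S (T t) = t) ∧ ContDiffOn ℝ ∞ S (T '' K) ∧ IsOpen (T '' K) := by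
  have hTs : ∀ t ∈ K, ContDiffAt ℝ ∞ T t := fun t ht => hT.contDiffAt (hK.mem_nhds ht)
  have hinj : InjOn T K := injOn_of_hasDerivAt_ne_zero ho
    (fun t ht => (differentiableAt_of_smooth (hTs t ht)).hasDerivAt) hd
  have hleft : ∀ t ∈ K, Function.invFunOn T K (T t) = t := fun t ht => hinj.leftInvOn_invFunOn ht
  have loc : ∀ t ∈ K, ∃ S₀ : ℝ → ℝ, ContDiffAt ℝ ∞ S₀ (T t) ∧
      ∀ᶠ y in 𝓝 (T t), T (S₀ y) = y ∧ S₀ y ∈ K := by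
    intro t ht
    have hdt : (fderiv ℝ T t).det ≠ 0 := by
      refine det_ne_zero_of_injective _ fun w hw => ?_
      rw [fderiv_eq_smul_deriv, smul_eq_mul] at hw
      exact (mul_eq_zero.1 hw).resolve_right (hd t ht)
    obtain ⟨Le, hLe⟩ := exists_equiv_of_det_ne_zero _ hdt
    obtain ⟨S₀, h1, h2, h3, -, -⟩ := exists_local_inverse (hTs t ht) Le
      (hLe ▸ (differentiableAt_of_smooth (hTs t ht)).hasFDerivAt)
    have h4 : Tendsto S₀ (𝓝 (T t)) (𝓝 t) := by
      have := h1.continuousAt.tendsto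
      rwa [h2] at this
    exact ⟨S₀, h1, h3.and (h4 (hK.mem_nhds ht))⟩
  -- The local inverses take values in `K`, where T is injective, so the set-theoretic inverse
  -- agrees with them locally and inherits smoothness.
  refine ⟨Function.invFunOn T K, hleft, ?_, ?_⟩
  · rintro _ ⟨t, ht, rfl⟩
    obtain ⟨S₀, h1, h2⟩ := loc t ht
    refine (h1.congr_of_eventuallyEq ?_).contDiffWithinAt
    filter_upwards [h2] with y hy
    have := hleft _ hy.2
    rwa [hy.1] at this
  · rw [isOpen_iff_mem_nhds]
    rintro _ ⟨t, ht, rfl⟩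
    obtain ⟨S₀, -, h2⟩ := loc t ht
    filter_upwards [h2] with y hy
    exact ⟨S₀ y, hy.2, hy.1⟩

end OneVariable

/-! ### From local conditions to the global normal form. -/

theorem exists_const_of_partials {Ω : Set TXU} (hΩ : IsOpen Ω) (hc : IsConnected Ω)
    {A : TXU → ℝ} (hA : ∀ z ∈ Ω, DifferentiableAt ℝ A z) (ht : ∀ z ∈ Ω, pt A z = 0)
    (hx : ∀ z ∈ Ω, px A z = 0) (hu : ∀ z ∈ Ω, pu A z = 0) : ∃ k, ∀ z ∈ Ω, A z = k := by
  refine hΩ.exists_is_const_of_fderiv_eq_zero hc.isPreconnected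
    (fun z hz => (hA z hz).differentiableWithinAt) fun z hz => ?_
  refine ContinuousLinearMap.ext fun w => ?_
  rw [show w = (w.1, w.2.1, w.2.2) from rfl, fderiv_eq_partials, ht z hz, hx z hz, hu z hz]
  simp

/-- The `(t, x, u)`-part of the elements of the usual equivalence group. -/
structure HasNormalForm (Ω : Set TXU) (Φ : TXU → TXU) (T : ℝ → ℝ) (δ₁ δ₂ δ₃ δ₄ : ℝ) : Prop where
  ne_zero : δ₁ * δ₃ ≠ 0
  smooth : ContDiffOn ℝ ∞ T (Prod.fst '' Ω)
  deriv_ne_zero : ∀ t ∈ Prod.fst '' Ω, deriv T t ≠ 0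
  eq : ∀ t x u : ℝ, (t, x, u) ∈ Ω → Φ (t, x, u) = (T t, δ₁ * x + δ₂, δ₃ * u + δ₄)

theorem dirDeriv_sub_mul {A B : TXU → ℝ} {z : TXU} (hA : DifferentiableAt ℝ A z)
    (hB : DifferentiableAt ℝ B z) (k : ℝ) (e : TXU) :
    dirDeriv e (fun y => A y - k * B y) z = dirDeriv e A z - k * dirDeriv e B z := by
  simp [dirDeriv, fderiv_fun_sub hA (hB.const_mul k), fderiv_const_mul hB]

theorem dirDeriv_coords (z : TXU) :
    (∀ e, dirDeriv e (fun y : TXU => y.1) z = e.1) ∧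
    (∀ e, dirDeriv e (fun y : TXU => y.2.1) z = e.2.1) ∧
    (∀ e, dirDeriv e (fun y : TXU => y.2.2) z = e.2.2) := by
  have h1 : HasFDerivAt (fun y : TXU => y.1) (ContinuousLinearMap.fst ℝ ℝ (ℝ × ℝ)) z :=
    hasFDerivAt_fst
  have h2 : HasFDerivAt (fun y : TXU => y.2) (ContinuousLinearMap.snd ℝ ℝ (ℝ × ℝ)) z :=
    hasFDerivAt_snd
  refine ⟨fun e => ?_, fun e => ?_, fun e => ?_⟩
  · rw [dirDeriv, h1.fderiv]; rfl
  · rw [dirDeriv, h2.fst.fderiv]; rfl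
  · rw [dirDeriv, h2.snd.fderiv]; rfl

/-- T_x = T_u = 0 makes T constant only on connected components of the slices t = const. To compare
components, take primitives G, G̃ of g, g̃: the relation δ₃ T_t g̃(T) = δ₁ g says that δ₃ G̃(T) - δ₁
G(t) has zero differential, hence is constant on the connected set Ω. Since g̃ ≠ 0, G̃ is injective
on its interval, so t determines T. -/
theorem MapsEquation.exists_normalForm {Ω : Set TXU} {Φ : TXU → TXU} {θ θ' : Equation}
    (hΦ : IsPointTransformation Ω Φ) (hΩ : IsOpen Ω) (hc : IsConnected Ω)
    (h : MapsEquation Ω Φ θ θ') :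
    ∃ T δ₁ δ₂ δ₃ δ₄, HasNormalForm Ω Φ T δ₁ δ₂ δ₃ δ₄ := by
  have D := fun z (hz : z ∈ Ω) => h.determinedAt hΦ hΩ hz
  have hs : ∀ z ∈ Ω, ContDiffAt ℝ ∞ Φ z := fun z hz => hΦ.1.contDiffAt (hΩ.mem_nhds hz)
  have sT := fun z (hz : z ∈ Ω) => contDiffAt_fst_comp (hs z hz)
  have sX := fun z (hz : z ∈ Ω) => contDiffAt_snd_fst_comp (hs z hz)
  have sU := fun z (hz : z ∈ Ω) => contDiffAt_snd_snd_comp (hs z hz)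
  have comm : ∀ {A : TXU → ℝ} (e e' : TXU), (∀ z ∈ Ω, ContDiffAt ℝ ∞ A z) →
      (∀ z ∈ Ω, dirDeriv e A z = 0) → ∀ z ∈ Ω, dirDeriv e (dirDeriv e' A) z = 0 := by
    intro A e e' hA h0 z hz
    rw [dirDeriv_comm _ _ (hA z hz)]
    exact dirDeriv_zero_of_forall hΩ h0 _ z hz
  have mk : ∀ {A : TXU → ℝ}, (∀ z ∈ Ω, ContDiffAt ℝ ∞ A z) → ∀ z ∈ Ω, DifferentiableAt ℝ A z :=
    fun hA z hz => differentiableAt_of_smooth (hA z hz)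
  have dx' : ∀ z : TXU, DifferentiableAt ℝ (fun y : TXU => y.2.1) z := fun z => by fun_prop
  have du' : ∀ z : TXU, DifferentiableAt ℝ (fun y : TXU => y.2.2) z := fun z => by fun_prop
  obtain ⟨δ₁, hδ₁⟩ := exists_const_of_partials hΩ hc
    (mk fun z hz => contDiffAt_px (sX z hz)) (comm _ _ sX fun z hz => (D z hz).Xt)
    (fun z hz => (D z hz).Xxx) (comm _ _ sX fun z hz => (D z hz).Xu)
  obtain ⟨δ₃, hδ₃⟩ := exists_const_of_partials hΩ hc
    (mk fun z hz => contDiffAt_pu (sU z hz)) (comm _ _ sU fun z hz => (D z hz).Ut)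
    (comm _ _ sU fun z hz => (D z hz).Ux) (fun z hz => (D z hz).Uuu)
  obtain ⟨δ₂, hδ₂⟩ := exists_const_of_partials hΩ hc (A := fun y => (Φ y).2.1 - δ₁ * y.2.1)
    (fun z hz => (mk sX z hz).sub ((dx' z).const_mul δ₁))
    (fun z hz => by
      rw [pt, dirDeriv_sub_mul (mk sX z hz) (dx' z), (dirDeriv_coords z).2.1]
      simpa using (D z hz).Xt)
    (fun z hz => by
      rw [px, dirDeriv_sub_mul (mk sX z hz) (dx' z), (dirDeriv_coords z).2.1]
      simpa [sub_eq_zero] using hδ₁ z hz)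
    (fun z hz => by
      rw [pu, dirDeriv_sub_mul (mk sX z hz) (dx' z), (dirDeriv_coords z).2.1]
      simpa using (D z hz).Xu)
  obtain ⟨δ₄, hδ₄⟩ := exists_const_of_partials hΩ hc (A := fun y => (Φ y).2.2 - δ₃ * y.2.2)
    (fun z hz => (mk sU z hz).sub ((du' z).const_mul δ₃))
    (fun z hz => by
      rw [pt, dirDeriv_sub_mul (mk sU z hz) (du' z), (dirDeriv_coords z).2.2]
      simpa using (D z hz).Ut)
    (fun z hz => by
      rw [px, dirDeriv_sub_mul (mk sU z hz) (du' z), (dirDeriv_coords z).2.2]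
      simpa using (D z hz).Ux)
    (fun z hz => by
      rw [pu, dirDeriv_sub_mul (mk sU z hz) (du' z), (dirDeriv_coords z).2.2]
      simpa [sub_eq_zero] using hδ₃ z hz)
  obtain ⟨z₀, hz₀⟩ := hc.nonempty
  have hδ₁0 : δ₁ ≠ 0 := hδ₁ z₀ hz₀ ▸ (D z₀ hz₀).Xx_ne
  have hδ₃0 : δ₃ ≠ 0 := hδ₃ z₀ hz₀ ▸ (D z₀ hz₀).Uu_ne
  obtain ⟨G, hG⟩ := exists_primitive θ.isOpen_I θ.isConnected_I θ.smooth_g.continuousOn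
  obtain ⟨G', hG'⟩ := exists_primitive θ'.isOpen_I θ'.isConnected_I θ'.smooth_g.continuousOn
  have hGinj : InjOn G' θ'.I := injOn_of_hasDerivAt_ne_zero
    θ'.isConnected_I.isPreconnected.ordConnected hG' fun t ht => θ'.g_ne_zero ht
  have hder : ∀ z ∈ Ω, HasFDerivAt (fun y => δ₃ * G' (Φ y).1 - δ₁ * G y.1)
      (δ₃ • θ'.g (Φ z).1 • fderiv ℝ (fun y => (Φ y).1) z
        - δ₁ • θ.g z.1 • ContinuousLinearMap.fst ℝ ℝ (ℝ × ℝ)) z := by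
    intro z hz
    exact (((hG' _ (h.1 z hz).2).comp_hasFDerivAt z (mk sT z hz).hasFDerivAt).const_mul δ₃).sub
      (((hG _ (h.1 z hz).1).comp_hasFDerivAt z (hasFDerivAt_fst (p := z))).const_mul δ₁)
  have hpart : ∀ z ∈ Ω, ∀ e : TXU, dirDeriv e (fun y => δ₃ * G' (Φ y).1 - δ₁ * G y.1) z =
      δ₃ * (θ'.g (Φ z).1 * dirDeriv e (fun y => (Φ y).1) z) - δ₁ * (θ.g z.1 * e.1) := by
    intro z hz e
    rw [dirDeriv, (hder z hz).fderiv]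
    rfl
  obtain ⟨k, hk⟩ := exists_const_of_partials hΩ hc
    (A := fun y => δ₃ * G' (Φ y).1 - δ₁ * G y.1) (fun z hz => (hder z hz).differentiableAt)
    (fun z hz => by
      have := (D z hz).g_eq
      rw [hδ₁ z hz, hδ₃ z hz] at this
      rw [pt, hpart z hz]
      linear_combination this)
    (fun z hz => by
      rw [px, hpart z hz, show dirDeriv (0, 1, 0) _ z = 0 from (D z hz).Tx]
      ring)
    (fun z hz => by
      rw [pu, hpart z hz, show dirDeriv (0, 0, 1) _ z = 0 from (D z hz).Tu]
      ring)
  have hTfun : ∀ z ∈ Ω, ∀ z' ∈ Ω, z.1 = z'.1 → (Φ z).1 = (Φ z').1 := by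
    intro z hz z' hz' he
    refine hGinj (h.1 z hz).2 (h.1 z' hz').2 (mul_left_cancel₀ hδ₃0 ?_)
    have h1 := hk z hz
    have h2 := hk z' hz'
    rw [he] at h1
    linarith
  -- Evaluation at a chosen point of Ω above t; by `hTfun` the choice is immaterial, and off the
  -- projection of Ω the value plays no role.
  set T : ℝ → ℝ := fun t => (Φ (Function.invFunOn Prod.fst Ω t)).1 with hT
  have hTeq : ∀ z ∈ Ω, T z.1 = (Φ z).1 := by
    intro z hz
    have hex : ∃ y ∈ Ω, y.1 = z.1 := ⟨z, hz, rfl⟩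
    exact hTfun _ (Function.invFunOn_mem hex) z hz (Function.invFunOn_eq hex)
  have hTloc : ∀ z ∈ Ω, T =ᶠ[𝓝 z.1] fun t => (Φ (t, z.2)).1 := by
    intro z hz
    have hcont : Continuous fun t : ℝ => ((t, z.2) : TXU) := by fun_prop
    have := hcont.continuousAt.tendsto (x := z.1) (hΩ.mem_nhds (x := (z.1, z.2)) hz)
    filter_upwards [this] with t ht
    exact hTeq (t, z.2) ht
  refine ⟨T, δ₁, δ₂, δ₃, δ₄, mul_ne_zero hδ₁0 hδ₃0, ?_, ?_, ?_⟩
  · rintro _ ⟨z, hz, rfl⟩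
    have h1 : ContDiffAt ℝ ∞ (fun t : ℝ => ((t, z.2) : TXU)) z.1 :=
      contDiffAt_id.prodMk contDiffAt_const
    exact ((ContDiffAt.comp (g := fun y => (Φ y).1) z.1 (sT z hz) h1).congr_of_eventuallyEq
      (hTloc z hz)).contDiffWithinAt
  · rintro _ ⟨z, hz, rfl⟩
    rw [(hTloc z hz).deriv_eq]
    have h1 : HasDerivAt (fun t : ℝ => ((t, z.2) : TXU)) (1, 0) z.1 :=
      (hasDerivAt_id _).prodMk (hasDerivAt_const _ _)
    have h2 := HasFDerivAt.comp_hasDerivAt (l := fun y => (Φ y).1) z.1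
      (mk sT z hz).hasFDerivAt h1
    rw [show deriv (fun t => (Φ (t, z.2)).1) z.1 = _ from h2.deriv]
    exact (D z hz).Tt_ne
  · intro t x u hz
    have h1 := hδ₂ _ hz
    have h2 := hδ₄ _ hz
    refine Prod.ext (hTeq _ hz).symm (Prod.ext ?_ ?_)
    · simp only at h1 ⊢; linarith
    · simp only at h2 ⊢; linarith

/-! ### Transformations in normal form and their action on equations. -/

section NormalForm

variable {Ω : Set TXU} {Φ : TXU → TXU} {T : ℝ → ℝ} {δ₁ δ₂ δ₃ δ₄ : ℝ}

theorem HasNormalForm.contDiffAt (N : HasNormalForm Ω Φ T δ₁ δ₂ δ₃ δ₄) (hΩ : IsOpen Ω)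
    {z : TXU} (hz : z ∈ Ω) : ContDiffAt ℝ ∞ T z.1 :=
  N.smooth.contDiffAt ((isOpenMap_fst Ω hΩ).mem_nhds ⟨z, hz, rfl⟩)

theorem HasNormalForm.eventuallyEq (N : HasNormalForm Ω Φ T δ₁ δ₂ δ₃ δ₄) (hΩ : IsOpen Ω)
    {z : TXU} (hz : z ∈ Ω) :
    Φ =ᶠ[𝓝 z] fun y => (T y.1, δ₁ * y.2.1 + δ₂, δ₃ * y.2.2 + δ₄) := by
  filter_upwards [hΩ.mem_nhds hz] with y hy
  exact N.eq y.1 y.2.1 y.2.2 hy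

theorem HasNormalForm.partials (N : HasNormalForm Ω Φ T δ₁ δ₂ δ₃ δ₄) (hΩ : IsOpen Ω)
    {z : TXU} (hz : z ∈ Ω) (e : TXU) :
    dirDeriv e (fun y => (Φ y).1) z = deriv T z.1 * e.1 ∧
    dirDeriv e (fun y => (Φ y).2.1) z = δ₁ * e.2.1 ∧
    dirDeriv e (fun y => (Φ y).2.2) z = δ₃ * e.2.2 := by
  have he := N.eventuallyEq hΩ hz
  have hf : HasFDerivAt (fun y : TXU => y.1) (ContinuousLinearMap.fst ℝ ℝ (ℝ × ℝ)) z :=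
    hasFDerivAt_fst
  have h0 : HasFDerivAt (fun y : TXU => y.2) (ContinuousLinearMap.snd ℝ ℝ (ℝ × ℝ)) z :=
    hasFDerivAt_snd
  refine ⟨?_, ?_, ?_⟩
  · have h1 : (fun y => (Φ y).1) =ᶠ[𝓝 z] fun y => T y.1 := by
      filter_upwards [he] with y hy; rw [hy]
    rw [(dirDeriv_congr e h1).self_of_nhds]
    have h2 := (differentiableAt_of_smooth (N.contDiffAt hΩ hz)).hasDerivAt.comp_hasFDerivAt z hf
    rw [dirDeriv, show fderiv ℝ (fun y : TXU => T y.1) z = _ from h2.fderiv]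
    rfl
  · have h1 : (fun y => (Φ y).2.1) =ᶠ[𝓝 z] fun y => δ₁ * y.2.1 + δ₂ := by
      filter_upwards [he] with y hy; rw [hy]
    rw [(dirDeriv_congr e h1).self_of_nhds, dirDeriv,
      ((h0.fst.const_mul δ₁).add_const δ₂).fderiv]
    rfl
  · have h1 : (fun y => (Φ y).2.2) =ᶠ[𝓝 z] fun y => δ₃ * y.2.2 + δ₄ := by
      filter_upwards [he] with y hy; rw [hy]
    rw [(dirDeriv_congr e h1).self_of_nhds, dirDeriv,
      ((h0.snd.const_mul δ₃).add_const δ₄).fderiv]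
    rfl

theorem HasNormalForm.isPointTransformation (N : HasNormalForm Ω Φ T δ₁ δ₂ δ₃ δ₄)
    (hΩ : IsOpen Ω) : IsPointTransformation Ω Φ := by
  have hs : ∀ z ∈ Ω, ContDiffAt ℝ ∞ Φ z := by
    intro z hz
    refine ContDiffAt.congr_of_eventuallyEq ?_ (N.eventuallyEq hΩ hz)
    refine ((N.contDiffAt hΩ hz).comp z contDiffAt_fst).prodMk (ContDiffAt.prodMk ?_ ?_)
    · fun_prop
    · fun_prop
  refine ⟨fun z hz => (hs z hz).contDiffWithinAt, fun z hz => ?_⟩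
  refine det_ne_zero_of_injective _ fun w hw => ?_
  rw [fderiv_eq_triple (differentiableAt_of_smooth (hs z hz))] at hw
  obtain ⟨h1, h2, h3⟩ := N.partials hΩ hz w
  simp only [dirDeriv] at h1 h2 h3
  rw [h1, h2, h3] at hw
  simp only [Prod.mk_eq_zero, mul_eq_zero] at hw
  obtain ⟨w1, w2, w3⟩ := hw
  exact Prod.ext (w1.resolve_left (N.deriv_ne_zero _ ⟨z, hz, rfl⟩))
    (Prod.ext (w2.resolve_left (left_ne_zero_of_mul N.ne_zero))
      (w3.resolve_left (right_ne_zero_of_mul N.ne_zero)))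

/-- The components of an element of the usual equivalence group for the arbitrary elements. -/
noncomputable def coeffMap (T : ℝ → ℝ) (δ₁ δ₃ δ₄ : ℝ) (w : TXU × FGH) : FGH :=
  (δ₁ / (deriv T w.1.1 * δ₃) * (δ₃ * w.2.1 - δ₄ * w.2.2.1),
    δ₁ / (deriv T w.1.1 * δ₃) * w.2.2.1, δ₁ ^ 2 * w.2.2.2)

/-- A transformation in normal form determines the new coefficients. -/
theorem MapsEquation.coeff_eq {θ θ' : Equation} (hΩ : IsOpen Ω) (h : MapsEquation Ω Φ θ θ')
    (N : HasNormalForm Ω Φ T δ₁ δ₂ δ₃ δ₄) {z : TXU} (hz : z ∈ Ω) :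
    θ'.coeff (Φ z).1 = coeffMap T δ₁ δ₃ δ₄ (z, θ.coeff z.1) := by
  have D := h.determinedAt (N.isPointTransformation hΩ) hΩ hz
  have h1 := D.f_eq
  have h2 := D.g_eq
  have h3 := D.h_eq
  rw [pt, (N.partials hΩ hz _).1] at h1 h2
  rw [px, (N.partials hΩ hz _).2.1] at h1 h2 h3
  rw [pu, (N.partials hΩ hz _).2.2] at h2
  have hU : (Φ z).2.2 = δ₃ * z.2.2 + δ₄ := by rw [N.eq z.1 z.2.1 z.2.2 hz]
  rw [hU] at h1
  simp only [mul_one] at h1 h2 h3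
  have n1 := N.deriv_ne_zero z.1 ⟨z, hz, rfl⟩
  have n3 := right_ne_zero_of_mul N.ne_zero
  refine Prod.ext ?_ (Prod.ext ?_ ?_)
  · simp only [coeffMap, Equation.coeff]
    field_simp
    -- Subtracting U times the relation for g̃ removes g̃ from the relation for f̃; the terms in u
    -- cancel and -δ₄g remains.
    linear_combination δ₃ * h1 - (δ₃ * z.2.2 + δ₄) * h2
  · simp only [coeffMap, Equation.coeff]
    field_simp
    linear_combination h2
  · simp only [coeffMap, Equation.coeff]
    linear_combination h3

end NormalForm

section NormalForm

variable {Ω : Set TXU} {Φ : TXU → TXU} {T : ℝ → ℝ} {δ₁ δ₂ δ₃ δ₄ : ℝ}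

/-- The image of an equation under a transformation in normal form, where `S` inverts `T`. -/
noncomputable def Equation.image (θ : Equation) (T S : ℝ → ℝ) (δ₁ δ₃ δ₄ : ℝ) (K : Set ℝ)
    (hδ : δ₁ * δ₃ ≠ 0) (hKo : IsOpen K) (hKc : IsConnected K) (hKI : K ⊆ θ.I)
    (hT : ContDiffOn ℝ ∞ T K) (hd : ∀ t ∈ K, deriv T t ≠ 0) (hS : ∀ t ∈ K, S (T t) = t)
    (hSs : ContDiffOn ℝ ∞ S (T '' K)) (hTK : IsOpen (T '' K)) : Equation :=
  have hm : MapsTo S (T '' K) K := by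
    rintro _ ⟨t, ht, rfl⟩
    rwa [hS t ht]
  have hdT : ContDiffOn ℝ ∞ (deriv T) K := fun t ht =>
    (contDiffAt_deriv (hT.contDiffAt (hKo.mem_nhds ht))).contDiffWithinAt
  have hδ₃ : δ₃ ≠ 0 := right_ne_zero_of_mul hδ
  have hc : ContDiffOn ℝ ∞ (fun y => δ₁ / (deriv T (S y) * δ₃)) (T '' K) :=
    contDiffOn_const.div ((hdT.comp hSs hm).mul contDiffOn_const) fun y hy =>
      mul_ne_zero (hd _ (hm hy)) hδ₃
  have hf := (θ.smooth_f.mono hKI).comp hSs hm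
  have hg := (θ.smooth_g.mono hKI).comp hSs hm
  have hh := (θ.smooth_h.mono hKI).comp hSs hm
  { I := T '' K
    f := fun y => δ₁ / (deriv T (S y) * δ₃) * (δ₃ * θ.f (S y) - δ₄ * θ.g (S y))
    g := fun y => δ₁ / (deriv T (S y) * δ₃) * θ.g (S y)
    h := fun y => δ₁ ^ 2 * θ.h (S y)
    isOpen_I := hTK
    isConnected_I := hKc.image T hT.continuousOn
    smooth_f := hc.mul ((contDiffOn_const.mul hf).sub (contDiffOn_const.mul hg))
    smooth_g := hc.mul hg
    smooth_h := contDiffOn_const.mul hh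
    gh_ne_zero := fun y hy => by
      have h1 := hd _ (hm hy)
      have h2 := θ.g_ne_zero (hKI (hm hy))
      have h3 := θ.h_ne_zero (hKI (hm hy))
      have h4 := left_ne_zero_of_mul hδ
      positivity }

theorem dirDeriv_affine {E : Type*} [NormedAddCommGroup E] [NormedSpace ℝ E] {A : E → ℝ} {z : E}
    (e : E) (hA : ContDiffAt ℝ ∞ A z) (k c : ℝ) :
    dirDeriv e (fun y => k * A y + c) =ᶠ[𝓝 z] fun y => k * dirDeriv e A y := by
  filter_upwards [eventually_differentiableAt hA] with y hy
  simp [dirDeriv, fderiv_const_mul hy]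

/-- A transformation in normal form maps an equation to the equation with the transformed
coefficients. -/
theorem HasNormalForm.mapsEquation (N : HasNormalForm Ω Φ T δ₁ δ₂ δ₃ δ₄) (hΩ : IsOpen Ω)
    {Ω' : Set TXU} (hΩ' : Ω' ⊆ Ω) {θ θ' : Equation} (hI : ∀ z ∈ Ω', z.1 ∈ θ.I)
    (hI' : ∀ z ∈ Ω', T z.1 ∈ θ'.I)
    (hcoeff : ∀ z ∈ Ω', θ'.coeff (T z.1) = coeffMap T δ₁ δ₃ δ₄ (z, θ.coeff z.1)) :
    MapsEquation Ω' Φ θ θ' := by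
  have hΦT : ∀ z ∈ Ω, (Φ z).1 = T z.1 := fun z hz => by rw [N.eq z.1 z.2.1 z.2.2 hz]
  refine ⟨fun z hz => ⟨hI z hz, hΦT z (hΩ' hz) ▸ hI' z hz⟩, fun u v p hp htr => ?_⟩
  have hz := hΩ' hp
  have hu : ContDiffAt ℝ ∞ u p := htr.1
  have hΦ : ContDiffAt ℝ ∞ Φ (graphPoint u p) :=
    (N.isPointTransformation hΩ).1.contDiffAt (hΩ.mem_nhds hz)
  have zero : ∀ {A : TXU → ℝ}, (∀ z ∈ Ω, A z = 0) → A =ᶠ[𝓝 (graphPoint u p)] fun _ => 0 :=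
    fun h => eventually_zero_of_forall hΩ h hz
  obtain ⟨q0, q1, q2, q3⟩ := transformed_jets hΦ htr
    (zero fun z hz => by rw [px, (N.partials hΩ hz _).1, mul_zero])
    (zero fun z hz => by rw [pu, (N.partials hΩ hz _).1, mul_zero])
    (zero fun z hz => by rw [pt, (N.partials hΩ hz _).2.1, mul_zero])
    (zero fun z hz => by rw [pu, (N.partials hΩ hz _).2.1, mul_zero])
  have hXxx : px (px fun y => (Φ y).2.1) (graphPoint u p) = 0 := by
    have h1 : (px fun y => (Φ y).2.1) =ᶠ[𝓝 (graphPoint u p)] fun _ => δ₁ := by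
      filter_upwards [hΩ.mem_nhds hz] with y hy
      rw [px, (N.partials hΩ hy _).2.1, mul_one]
    rw [px, (dirDeriv_congr _ h1).self_of_nhds]
    simp [dirDeriv]
  have hgc : Tendsto (graphPoint u) (𝓝 p) (𝓝 (graphPoint u p)) :=
    (contDiffAt_graphPoint hu).continuousAt
  have hW : (fun q => (Φ (graphPoint u q)).2.2) =ᶠ[𝓝 p] fun q => δ₃ * u q + δ₄ := by
    filter_upwards [hgc.eventually (N.eventuallyEq hΩ hz)] with q hq
    rw [hq]
    rfl
  have ha : ∀ {A : ℝ × ℝ → ℝ} (e : ℝ × ℝ), ContDiffAt ℝ ∞ A p →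
      dirDeriv e (fun q => δ₃ * A q) =ᶠ[𝓝 p] fun q => δ₃ * dirDeriv e A q := fun e hA => by
    simpa using dirDeriv_affine e hA δ₃ 0
  have wt : dt (fun q => (Φ (graphPoint u q)).2.2) p = δ₃ * dt u p :=
    ((dirDeriv_congr (1, 0) hW).trans (dirDeriv_affine (1, 0) hu δ₃ δ₄)).self_of_nhds
  have wx := (dirDeriv_congr (0, 1) hW).trans (dirDeriv_affine (0, 1) hu δ₃ δ₄)
  have wx' : dx (fun q => (Φ (graphPoint u q)).2.2) p = δ₃ * dx u p := wx.self_of_nhds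
  have hux : ContDiffAt ℝ ∞ (dx u) p := contDiffAt_dirDeriv (0, 1) hu
  have wxx := (dirDeriv_congr (0, 1) wx).trans (ha (0, 1) hux)
  have wtxx : dt (dx (dx fun q => (Φ (graphPoint u q)).2.2)) p = δ₃ * dt (dx (dx u)) p :=
    ((dirDeriv_congr (1, 0) wxx).trans
      (ha (1, 0) (contDiffAt_dirDeriv (0, 1) hux))).self_of_nhds
  rw [pt, (N.partials hΩ hz _).1, wt] at q1
  rw [px, (N.partials hΩ hz _).2.1, wx'] at q2
  rw [hXxx, pt, (N.partials hΩ hz _).1, px, (N.partials hΩ hz _).2.1, wtxx] at q3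
  rw [show (Φ (graphPoint u p)).2.2 = δ₃ * u p + δ₄ from hW.self_of_nhds] at q0
  have hN1 : (newBase Φ u p).1 = T p.1 := hΦT _ hz
  have hc := hcoeff _ hp
  simp only [coeffMap, Equation.coeff, graphPoint, Prod.mk.injEq] at hc
  obtain ⟨c1, c2, c3⟩ := hc
  simp only [graphPoint, mul_one, zero_mul, sub_zero] at q1 q2 q3
  have n1 : deriv T p.1 ≠ 0 := N.deriv_ne_zero _ ⟨_, hz, rfl⟩
  have n2 := left_ne_zero_of_mul N.ne_zero
  have n3 := right_ne_zero_of_mul N.ne_zero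
  have e1 : dt v (newBase Φ u p) = δ₃ * dt u p / deriv T p.1 := by
    field_simp; linear_combination q1
  have e2 : dx v (newBase Φ u p) = δ₃ * dx u p / δ₁ := by
    field_simp; linear_combination q2
  have e3 : dt (dx (dx v)) (newBase Φ u p) =
      δ₃ * dt (dx (dx u)) p / (deriv T p.1 * δ₁ ^ 2) := by
    field_simp
    refine mul_left_cancel₀ n2 ?_
    linear_combination q3
  -- The left-hand sides of the two equations differ by the nonzero factor δ₃/T_t, which gives both
  -- directions of the equivalence.
  have key : dt v (newBase Φ u p) + θ'.f (newBase Φ u p).1 * dx v (newBase Φ u p)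
      + θ'.g (newBase Φ u p).1 * v (newBase Φ u p) * dx v (newBase Φ u p)
      + θ'.h (newBase Φ u p).1 * dt (dx (dx v)) (newBase Φ u p) =
      δ₃ / deriv T p.1 * (dt u p + θ.f p.1 * dx u p + θ.g p.1 * u p * dx u p
        + θ.h p.1 * dt (dx (dx u)) p) := by
    rw [hN1, c1, c2, c3, e1, e2, e3, q0]
    field_simp
    ring
  unfold Equation.HoldsAt
  rw [key]
  simp [n1, n3]

/-- Every transformation in normal form is a usual equivalence transformation. -/
theorem HasNormalForm.isUsualEquivalence (N : HasNormalForm Ω Φ T δ₁ δ₂ δ₃ δ₄) (hΩ : IsOpen Ω)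
    (hc : IsConnected Ω) {Θ : TXU × FGH → FGH}
    (hΘ : ∀ w : TXU × FGH, w.1 ∈ Ω → w.2.2.1 * w.2.2.2 ≠ 0 → Θ w = coeffMap T δ₁ δ₃ δ₄ w) :
    IsUsualEquivalence Ω Φ Θ := by
  have hPT := N.isPointTransformation hΩ
  have n2 := left_ne_zero_of_mul N.ne_zero
  have n3 := right_ne_zero_of_mul N.ne_zero
  refine ⟨hΩ, hc, hPT, ?_, ?_⟩
  · have hW : IsOpen {w : TXU × FGH | w.1 ∈ Ω ∧ w.2.2.1 * w.2.2.2 ≠ 0} := by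
      refine (hΩ.preimage continuous_fst).inter (isOpen_ne_fun ?_ ?_) <;> fun_prop
    have hΘs : ∀ w ∈ {w : TXU × FGH | w.1 ∈ Ω ∧ w.2.2.1 * w.2.2.2 ≠ 0},
        ContDiffAt ℝ ∞ Θ w := by
      intro w hw
      refine ContDiffAt.congr_of_eventuallyEq (f := coeffMap T δ₁ δ₃ δ₄) ?_ ?_
      · have hdT : ContDiffAt ℝ ∞ (fun y : TXU × FGH => deriv T y.1.1) w :=
          ContDiffAt.comp (g := deriv T) w (contDiffAt_deriv (N.contDiffAt hΩ hw.1))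
            (contDiffAt_fst.comp w contDiffAt_fst)
        have hq : ContDiffAt ℝ ∞ (fun y : TXU × FGH => δ₁ / (deriv T y.1.1 * δ₃)) w :=
          contDiffAt_const.div (hdT.mul contDiffAt_const)
            (mul_ne_zero (N.deriv_ne_zero _ ⟨_, hw.1, rfl⟩) n3)
        unfold coeffMap
        refine (hq.mul ?_).prodMk ((hq.mul ?_).prodMk ?_) <;> fun_prop
      · filter_upwards [hW.mem_nhds hw] with y hy
        exact hΘ y hy.1 hy.2
    have hΦs : ∀ w ∈ {w : TXU × FGH | w.1 ∈ Ω ∧ w.2.2.1 * w.2.2.2 ≠ 0},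
        ContDiffAt ℝ ∞ (fun w : TXU × FGH => Φ w.1) w := fun w hw =>
      (hPT.1.contDiffAt (hΩ.mem_nhds hw.1)).comp w contDiffAt_fst
    refine ⟨fun w hw => ((hΦs w hw).prodMk (hΘs w hw)).contDiffWithinAt, fun w hw => ?_⟩
    -- The joint Jacobian is block triangular. A kernel vector has zero (t, x, u)-part because dΦ is
    -- injective; on the rest, Θ is affine in (f, g, h), and its linear part is triangular with
    -- nonzero diagonal.
    refine det_ne_zero_of_injective _ fun d hd => ?_
    have hΘd := differentiableAt_of_smooth (hΘs w hw)
    have hΦd : HasFDerivAt (fun w : TXU × FGH => Φ w.1)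
        ((fderiv ℝ Φ w.1).comp (ContinuousLinearMap.fst ℝ TXU FGH)) w :=
      (differentiableAt_of_smooth (hPT.1.contDiffAt (hΩ.mem_nhds hw.1))).hasFDerivAt.comp w
        hasFDerivAt_fst
    rw [(hΦd.prodMk hΘd.hasFDerivAt).fderiv] at hd
    have hd1 : fderiv ℝ Φ w.1 d.1 = 0 := congrArg Prod.fst hd
    have hd2 : fderiv ℝ Θ w d = 0 := congrArg Prod.snd hd
    obtain ⟨Ψ, hΨ⟩ := exists_equiv_of_det_ne_zero _ (hPT.2 _ hw.1)
    have hd10 : d.1 = 0 := by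
      rw [← hΨ] at hd1
      simpa using hd1
    obtain ⟨d1, a, b, c⟩ := d
    simp only at hd10
    subst hd10
    set m := δ₁ / (deriv T w.1.1 * δ₃) with hm
    have hm0 : m ≠ 0 := div_ne_zero n2 (mul_ne_zero (N.deriv_ne_zero _ ⟨_, hw.1, rfl⟩) n3)
    have hl : HasDerivAt (fun s : ℝ => w + s • ((0, a, b, c) : TXU × FGH)) (0, a, b, c) 0 := by
      simpa using ((hasDerivAt_id (0 : ℝ)).smul_const ((0, a, b, c) : TXU × FGH)).const_add w
    have hl0 : HasDerivAt (fun s : ℝ => Θ (w + s • ((0, a, b, c) : TXU × FGH)))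
        (fderiv ℝ Θ w (0, a, b, c)) 0 := by
      refine HasFDerivAt.comp_hasDerivAt (l := Θ) (0 : ℝ) ?_ hl
      simpa using hΘd.hasFDerivAt
    have aff : ∀ k l : ℝ, HasDerivAt (fun s : ℝ => k + s * l) l 0 := fun k l => by
      simpa using ((hasDerivAt_id (0 : ℝ)).mul_const l).const_add k
    have hl1 : HasDerivAt (fun s : ℝ => ((m * (δ₃ * (w.2.1 + s * a) - δ₄ * (w.2.2.1 + s * b)),
        m * (w.2.2.1 + s * b), δ₁ ^ 2 * (w.2.2.2 + s * c)) : FGH))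
        (m * (δ₃ * a - δ₄ * b), m * b, δ₁ ^ 2 * c) 0 :=
      ((((aff _ a).const_mul δ₃).sub ((aff _ b).const_mul δ₄)).const_mul m).prodMk
        (((aff _ b).const_mul m).prodMk ((aff _ c).const_mul _))
    have hev : (fun s : ℝ => Θ (w + s • ((0, a, b, c) : TXU × FGH))) =ᶠ[𝓝 0] fun s : ℝ =>
        ((m * (δ₃ * (w.2.1 + s * a) - δ₄ * (w.2.2.1 + s * b)),
        m * (w.2.2.1 + s * b), δ₁ ^ 2 * (w.2.2.2 + s * c)) : FGH) := by
      have ht : Tendsto (fun s : ℝ => w + s • ((0, a, b, c) : TXU × FGH)) (𝓝 0) (𝓝 w) := by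
        simpa using hl.continuousAt.tendsto
      filter_upwards [ht (hW.mem_nhds hw)] with s hs
      rw [hΘ _ hs.1 hs.2]
      simp [coeffMap, hm]
    have huniq := hl0.unique (hl1.congr_of_eventuallyEq hev)
    rw [hd2] at huniq
    have u1 := congrArg Prod.fst huniq
    have u2 := congrArg (fun k : FGH => k.2.1) huniq
    have u3 := congrArg (fun k : FGH => k.2.2) huniq
    simp only [Prod.fst_zero, Prod.snd_zero] at u1 u2 u3
    have b0 : b = 0 := (mul_eq_zero.1 u2.symm).resolve_left hm0
    have c0 : c = 0 := (mul_eq_zero.1 u3.symm).resolve_left (pow_ne_zero _ n2)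
    have a0 : a = 0 := by
      have := (mul_eq_zero.1 u1.symm).resolve_left hm0
      rw [b0, mul_zero, sub_zero] at this
      exact (mul_eq_zero.1 this).resolve_left n3
    rw [a0, b0, c0]
    rfl
  · intro θ
    -- An `Equation` needs a nonempty interval. If `θ.I` misses the projection of Ω there is no
    -- image interval, but then the restricted domain is empty and any equation serves.
    by_cases hne : (θ.I ∩ Prod.fst '' Ω).Nonempty
    · set K := θ.I ∩ Prod.fst '' Ω with hK
      have hKo : IsOpen K := θ.isOpen_I.inter (isOpenMap_fst Ω hΩ)
      -- An intersection of two intervals is an interval; this makes `T '' K` a legitimate interval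
      -- for the image equation.
      have hKord : OrdConnected K := θ.isConnected_I.isPreconnected.ordConnected.inter
        (hc.image _ continuous_fst.continuousOn).isPreconnected.ordConnected
      have hKc : IsConnected K := ⟨hne, hKord.isPreconnected⟩
      have hTK : ContDiffOn ℝ ∞ T K := N.smooth.mono inter_subset_right
      have hdK : ∀ t ∈ K, deriv T t ≠ 0 := fun t ht => N.deriv_ne_zero t ht.2
      obtain ⟨S, hS, hSs, hTo⟩ := exists_smooth_inverse hKo hKord hTK hdK
      set θ' := θ.image T S δ₁ δ₃ δ₄ K N.ne_zero hKo hKc inter_subset_left hTK hdK hS hSs hTo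
        with hθ'
      have hmem : ∀ z ∈ {z ∈ Ω | z.1 ∈ θ.I}, z.1 ∈ K := fun z hz => ⟨hz.2, z, hz.1, rfl⟩
      have hco : ∀ z ∈ {z ∈ Ω | z.1 ∈ θ.I},
          θ'.coeff (T z.1) = coeffMap T δ₁ δ₃ δ₄ (z, θ.coeff z.1) := by
        intro z hz
        simp only [Equation.coeff, coeffMap, hθ', Equation.image, hS _ (hmem z hz)]
      refine ⟨θ', N.mapsEquation hΩ (fun z hz => hz.1) (fun z hz => hz.2)
        (fun z hz => ⟨z.1, hmem z hz, rfl⟩) hco, fun z hz => ?_⟩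
      rw [hΘ _ hz.1 (θ.gh_ne_zero _ hz.2), ← hco z hz, N.eq z.1 z.2.1 z.2.2 hz.1]
    · have hempty : ∀ z ∈ {z ∈ Ω | z.1 ∈ θ.I}, False := fun z hz =>
        hne ⟨z.1, hz.2, z, hz.1, rfl⟩
      exact ⟨θ, ⟨fun z hz => (hempty z hz).elim, fun u v p hp => (hempty _ hp).elim⟩,
        fun z hz => (hempty z hz).elim⟩

end NormalForm

/-! ### The usual equivalence group and normalization. -/

/-- The equation with constant coefficients. -/
noncomputable def constEquation (k : FGH) (hk : k.2.1 * k.2.2 ≠ 0) : Equation where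
  I := univ
  f := fun _ => k.1
  g := fun _ => k.2.1
  h := fun _ => k.2.2
  isOpen_I := isOpen_univ
  isConnected_I := isConnected_univ
  smooth_f := contDiffOn_const
  smooth_g := contDiffOn_const
  smooth_h := contDiffOn_const
  gh_ne_zero := fun _ _ => hk

/-- Every usual equivalence transformation has the normal form. -/
theorem IsUsualEquivalence.exists_normalForm {Ω : Set TXU} {Φ : TXU → TXU}
    {Θ : TXU × FGH → FGH} (h : IsUsualEquivalence Ω Φ Θ) :
    ∃ T δ₁ δ₂ δ₃ δ₄, HasNormalForm Ω Φ T δ₁ δ₂ δ₃ δ₄ ∧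
      ∀ w : TXU × FGH, w.1 ∈ Ω → w.2.2.1 * w.2.2.2 ≠ 0 → Θ w = coeffMap T δ₁ δ₃ δ₄ w := by
  obtain ⟨hΩ, hc, hPT, -, hmap⟩ := h
  -- Constant coefficients live on the whole line, so Ω is not cut down, and they realize every
  -- value (f, g, h) with gh ≠ 0 above every point of Ω.
  have hconst : ∀ (k : FGH) (hk : k.2.1 * k.2.2 ≠ 0), ∃ θ' : Equation,
      MapsEquation Ω Φ (constEquation k hk) θ' ∧ Induces Ω Φ Θ (constEquation k hk) θ' := by
    intro k hk
    have hset : {z ∈ Ω | z.1 ∈ (constEquation k hk).I} = Ω := by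
      ext z
      simp [constEquation]
    have := hmap (constEquation k hk)
    rwa [hset] at this
  -- A single equation already fixes T and the δ's, since `Φ` does not depend on the coefficients;
  -- the others only serve to evaluate Θ.
  obtain ⟨θ', hθ', -⟩ := hconst (0, 1, 1) (by norm_num)
  obtain ⟨T, δ₁, δ₂, δ₃, δ₄, N⟩ := hθ'.exists_normalForm hPT hΩ hc
  refine ⟨T, δ₁, δ₂, δ₃, δ₄, N, fun w hw hk => ?_⟩
  obtain ⟨θ'', h1, h2⟩ := hconst w.2 hk
  have h3 := h1.coeff_eq hΩ N hw
  rw [h2 _ hw] at h3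
  exact h3

end BBM

theorem theorem2 :
    (∀ (Ω : Set BBM.TXU) (Φ : BBM.TXU → BBM.TXU) (Θ : BBM.TXU × BBM.FGH → BBM.FGH),
      IsOpen Ω → IsConnected Ω →
      (BBM.IsUsualEquivalence Ω Φ Θ ↔
        ∃ (T : ℝ → ℝ) (δ₁ δ₂ δ₃ δ₄ : ℝ),
          δ₁ * δ₃ ≠ 0 ∧
          ContDiffOn ℝ ∞ T (Prod.fst '' Ω) ∧
          (∀ t ∈ Prod.fst '' Ω, deriv T t ≠ 0) ∧
          (∀ t x u : ℝ, (t, x, u) ∈ Ω →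
            Φ (t, x, u) = (T t, δ₁ * x + δ₂, δ₃ * u + δ₄)) ∧
          (∀ t x u f g h : ℝ, (t, x, u) ∈ Ω → g * h ≠ 0 →
            Θ ((t, x, u), (f, g, h)) =
              (δ₁ / (deriv T t * δ₃) * (δ₃ * f - δ₄ * g),
                δ₁ / (deriv T t * δ₃) * g,
                δ₁ ^ 2 * h)))) ∧
    BBM.IsNormalized := by
  refine ⟨fun Ω Φ Θ hΩ hc => ⟨fun h => ?_, ?_⟩, ?_⟩
  · obtain ⟨T, δ₁, δ₂, δ₃, δ₄, N, hΘ⟩ := h.exists_normalForm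
    exact ⟨T, δ₁, δ₂, δ₃, δ₄, N.ne_zero, N.smooth, N.deriv_ne_zero, N.eq,
      fun t x u f g h hz hgh => hΘ ((t, x, u), (f, g, h)) hz hgh⟩
  · rintro ⟨T, δ₁, δ₂, δ₃, δ₄, h1, h2, h3, h4, h5⟩
    exact BBM.HasNormalForm.isUsualEquivalence ⟨h1, h2, h3, h4⟩ hΩ hc
      fun w hw hk => h5 w.1.1 w.1.2.1 w.1.2.2 w.2.1 w.2.2.1 w.2.2.2 hw hk
  -- One pair of equations suffices for the normal form, so an admissible transformation extends to
  -- the whole class by `coeffMap`.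
  · rintro Ω Φ θ θ' ⟨hΩ, hc, hPT, hmap⟩
    obtain ⟨T, δ₁, δ₂, δ₃, δ₄, N⟩ := hmap.exists_normalForm hPT hΩ hc
    exact ⟨BBM.coeffMap T δ₁ δ₃ δ₄, N.isUsualEquivalence hΩ hc fun _ _ _ => rfl,
      fun z hz => hmap.coeff_eq hΩ N hz⟩
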